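/- Let $X\subset\mathcal A^{\mathbb Z}$ be an irreducible 1-step shift of finite type over a finite alphabet $\mathcal A$ (for all words $u,v$ and every symbol $a$, if $ua$ and $av$ occur in $X$, then so does $uav$), and let $\pi:X\to Y$ be a 1-block factor code onto a (hence sofic) shift space $Y$. Write $\mathcal B(\cdot)$ for the set of words occurring in a shift space and $\mathcal B_N(\cdot)$ for those of length $N$; $\pi$ also acts symbolwise on words. For $x,x'\in X$ with $\pi(x)=\pi(x')$ write $x\to^r x'$ if for every $m\in\mathbb Z$ there are $z\in X$ and $n>m$ with $\pi(z)=\pi(x)$, $z_i=x_i$ for all $i\le m$ and $z_i=x'_i$ for all $i\ge n$. Write $x\sim^r x'$ if $x\to^r x'$ and $x'\to^r x$. Let $d^r_\pi(y)$ be the number of $\sim^r$-classes in $\pi^{-1}(y)$, and let $d_\pi=\min_{y\in Y}d^r_\pi(y)$ be the class degree. The code $\pi$ is constant-class-to-one if $d^r_\pi(y)=d_\pi$ for all $y\in Y$. The relation $\sim^l$ is defined in the same way with time reversed. For a word $w=w_1\cdots w_l\in\mathcal B(Y)$, the depth $d_\pi(w)$ is the least cardinality of a set $M\subset\mathcal A$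 such that for some $1<n<l$ the following holds: for every $u\in\pi^{-1}(w)$ there is $v\in\pi^{-1}(w)$ with $v_1=u_1$, $v_l=u_l$ and $v_n\in M$ (the depth is $\infty$ if $l\le 2$). For $l\ge1$, a set $W\subset\pi^{-1}(w)$ is tangled if for all $u,u'\in W$ there is $v\in\pi^{-1}(w)$ with $v_1=u_1$ and $v_l=u'_l$; the t-depth $\tau_\pi(w)$ is the least cardinality of a partition of $\pi^{-1}(w)$ into tangled sets. **Theorem.** For every $d\in\mathbb N$ the following are equivalent: 1. $\pi$ is constant-class-to-one and $d_\pi=d$. 2. $d$ is the minimal depth of the nonempty words in $\mathcal B(Y)$, and there is $N>0$ such that all words in $\mathcal B_N(Y)$ have depth $d$. 3. $d$ is the minimal t-depth of the nonempty words in $\mathcal B(Y)$, and there is $N>0$ such that all words in $\mathcal B_N(Y)$ have t-depth $d$. If any of these conditions holds, then $\pi$ is bi-class-closing and bi-continuing. That is: any two left (resp. right) asymptotic points of $X$ with the same image are related by $\sim^r$ (resp. $\sim^l$); and for all $x\in X$ and all $y\in Y$ left (resp. right) asymptotic to $\pi(x)$ there is $x'\in\pi^{-1}(y)$ left (resp.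 right) asymptotic to $x$. Here two points are left (resp. right) asymptotic if they agree at all coordinates $\le n$ (resp. $\ge n$) for some $n\in\mathbb Z$. -/

import Mathlib

open SymbolicDynamics.FullShift

namespace ClassDegree

section Words

variable {A : Type*}

/-- The word of length `l` that occurs in the bi-infinite sequence `x` at coordinate `i`,
that is, `x_i x_{i+1} … x_{i+l-1}`. -/
def block (x : ℤ → A) (i : ℤ) (l : ℕ) : List A :=
  List.ofFn fun k : Fin l => x (i + (k : ℕ))

variable [TopologicalSpace A]

/-- `B(X)`: the set of all words occurring in the points of `X`. -/
def language (X : Subshift A ℤ) : Set (List A) :=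
  {w | ∃ x ∈ X.carrier, ∃ i : ℤ, w = block x i w.length}

/-- `X` is irreducible: any two words of `X` can be joined within a word of `X`. -/
def IsIrreducible (X : Subshift A ℤ) : Prop :=
  ∀ u ∈ language X, ∀ v ∈ language X, ∃ w : List A, u ++ w ++ v ∈ language X

/-- The word `w` of `X` is synchronizing. -/
def IsSynchronizing (X : Subshift A ℤ) (w : List A) : Prop :=
  ∀ u v : List A, u ++ w ∈ language X → w ++ v ∈ language X → u ++ w ++ v ∈ language X

/-- `X` is a `k`-step shift of finite type: each word of `X` of length `k` is synchronizing. -/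
def IsStepSFT (k : ℕ) (X : Subshift A ℤ) : Prop :=
  ∀ w ∈ language X, w.length = k → IsSynchronizing X w

end Words

section Asymptotic

variable {A : Type*}

/-- The two sequences agree on some left-infinite interval of coordinates. -/
def LeftAsymptotic (x x' : ℤ → A) : Prop := ∃ n : ℤ, ∀ i ≤ n, x i = x' i

/-- The two sequences agree on some right-infinite interval of coordinates. -/
def RightAsymptotic (x x' : ℤ → A) : Prop := ∃ n : ℤ, ∀ i ≥ n, x i = x' i

end Asymptotic

/-- A factor code: a continuous, shift-commuting, surjective map between shift spaces. -/
structure FactorCode {A B : Type*} [TopologicalSpace A] [TopologicalSpace B]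
    (X : Subshift A ℤ) (Y : Subshift B ℤ) where
  toFun : X.carrier → Y.carrier
  continuous_toFun : Continuous toFun
  map_shift : ∀ x : X.carrier,
    (toFun ⟨shift (1 : ℤ) x.1, X.mapsTo 1 x.2⟩).1 = shift (1 : ℤ) (toFun x).1
  surjective_toFun : Function.Surjective toFun

namespace FactorCode

variable {A B : Type*} [TopologicalSpace A] [TopologicalSpace B]
  {X : Subshift A ℤ} {Y : Subshift B ℤ} (π : FactorCode X Y)

/-- `π` is a 1-block code: `x_0` determines `π(x)_0`. -/
def IsOneBlock : Prop :=
  ∀ x x' : X.carrier, x.1 0 = x'.1 0 → (π.toFun x).1 0 = (π.toFun x').1 0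

/-! ### Transition classes -/

/-- `z` is a right `m`-bridge from `x` to `x'`. -/
def IsRightBridge (m : ℤ) (x x' z : X.carrier) : Prop :=
  π.toFun x = π.toFun x' ∧ π.toFun z = π.toFun x ∧ (∀ i ≤ m, z.1 i = x.1 i) ∧
    ∃ n > m, ∀ i ≥ n, z.1 i = x'.1 i

/-- `z` is a left `m`-bridge from `x` to `x'`. -/
def IsLeftBridge (m : ℤ) (x x' z : X.carrier) : Prop :=
  π.toFun x = π.toFun x' ∧ π.toFun z = π.toFun x ∧ (∀ i ≥ m, z.1 i = x.1 i) ∧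
    ∃ n < m, ∀ i ≤ n, z.1 i = x'.1 i

/-- There is a right transition from `x` to `x'`. -/
def RightTransition (x x' : X.carrier) : Prop := ∀ m : ℤ, ∃ z, π.IsRightBridge m x x' z

/-- There is a left transition from `x` to `x'`. -/
def LeftTransition (x x' : X.carrier) : Prop := ∀ m : ℤ, ∃ z, π.IsLeftBridge m x x' z

/-- `x` and `x'` are right equivalent. -/
def RightEquiv (x x' : X.carrier) : Prop := π.RightTransition x x' ∧ π.RightTransition x' x

/-- `x` and `x'` are left equivalent. -/
def LeftEquiv (x x' : X.carrier) : Prop := π.LeftTransition x x' ∧ π.LeftTransition x' x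

/-- The right transition class of `x`. -/
def rightClass (x : X.carrier) : Set X.carrier := {x' | π.RightEquiv x x'}

/-- The set of right transition classes over `y`. -/
def rightClasses (y : Y.carrier) : Set (Set X.carrier) :=
  {C | ∃ x : X.carrier, π.toFun x = y ∧ C = π.rightClass x}

/-- The number of right transition classes over `y`. -/
noncomputable def rightClassCount (y : Y.carrier) : ℕ∞ := (π.rightClasses y).encard

/-- The class degree: the minimal number of right transition classes over a point of `Y`. -/
noncomputable def classDegree : ℕ∞ := ⨅ y : Y.carrier, π.rightClassCount y

/-- Each point of `Y` has exactly `classDegree` many right transition classes. -/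
def IsConstantClassToOne : Prop := ∀ y : Y.carrier, π.rightClassCount y = π.classDegree

/-! ### Class-closing and continuing codes -/

def IsRightClassClosing : Prop :=
  ∀ x x' : X.carrier, LeftAsymptotic x.1 x'.1 → π.toFun x = π.toFun x' → π.RightEquiv x x'

def IsLeftClassClosing : Prop :=
  ∀ x x' : X.carrier, RightAsymptotic x.1 x'.1 → π.toFun x = π.toFun x' → π.LeftEquiv x x'

def IsBiClassClosing : Prop := π.IsRightClassClosing ∧ π.IsLeftClassClosing

def IsRightContinuing : Prop :=
  ∀ (x : X.carrier) (y : Y.carrier), LeftAsymptotic y.1 (π.toFun x).1 →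
    ∃ x' : X.carrier, π.toFun x' = y ∧ LeftAsymptotic x'.1 x.1

def IsLeftContinuing : Prop :=
  ∀ (x : X.carrier) (y : Y.carrier), RightAsymptotic y.1 (π.toFun x).1 →
    ∃ x' : X.carrier, π.toFun x' = y ∧ RightAsymptotic x'.1 x.1

def IsBiContinuing : Prop := π.IsRightContinuing ∧ π.IsLeftContinuing

/-! ### Depth and t-depth of words

These notions are meant for 1-block codes. Such a code acts on words symbol by symbol: if `u` occurs
in `x` at coordinate `i`, then the image word of `u` occurs in `π(x)` at the same coordinate. -/

/-- `π⁻¹(w)`: the set of the words of `X` that the 1-block code `π` maps to the word `w`. -/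
def wordFiber (w : List B) : Set (List A) :=
  {u | ∃ (x : X.carrier) (i : ℤ),
    u = block x.1 i w.length ∧ w = block (π.toFun x).1 i w.length}

/-- `u` is routable through the set `M` of symbols at the position `n`, where `u ∈ π⁻¹(w)`
and positions are numbered from `0`. -/
def IsRoutable (w : List B) (u : List A) (M : Set A) (n : ℕ) : Prop :=
  ∃ v ∈ π.wordFiber w, v.head? = u.head? ∧ v.getLast? = u.getLast? ∧ ∃ a ∈ M, v[n]? = some a

/-- All words of `π⁻¹(w)` are routable through `M` at the position `n`. -/
def IsFiberRoutable (w : List B) (M : Set A) (n : ℕ) : Prop :=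
  ∀ u ∈ π.wordFiber w, π.IsRoutable w u M n

/-- The depth of the word `w`: the least cardinality of a set of symbols through which `w` is
fibre-routable at a position strictly between the first and the last one. Words without such a
position have depth `⊤`. -/
noncomputable def depth (w : List B) : ℕ∞ :=
  sInf {c | ∃ (n : ℕ) (M : Set A), 0 < n ∧ n + 1 < w.length ∧ π.IsFiberRoutable w M n ∧
    c = M.encard}

/-- `v` is a bridge from `u` to `u'`, where `u, u' ∈ π⁻¹(w)`. -/
def IsBridge (w : List B) (u u' v : List A) : Prop :=
  v ∈ π.wordFiber w ∧ v.head? = u.head? ∧ v.getLast? = u'.getLast?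

/-- The set `W` is a tangled subset of `π⁻¹(w)`: there is a 2-way bridge between any two words
of `W`. -/
def IsTangled (w : List B) (W : Set (List A)) : Prop :=
  W ⊆ π.wordFiber w ∧ ∀ u ∈ W, ∀ u' ∈ W,
    (∃ v, π.IsBridge w u u' v) ∧ ∃ v, π.IsBridge w u' u v

/-- `P` is a partition of `π⁻¹(w)` into tangled sets. -/
def IsTangledPartition (w : List B) (P : Set (Set (List A))) : Prop :=
  ⋃₀ P = π.wordFiber w ∧ ∅ ∉ P ∧ P.PairwiseDisjoint id ∧ ∀ W ∈ P, π.IsTangled w W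

/-- The t-depth of the nonempty word `w`: the least cardinality of a tangled partition. -/
noncomputable def tDepth (w : List B) : ℕ∞ :=
  sInf {c | ∃ P : Set (Set (List A)), π.IsTangledPartition w P ∧ c = P.encard}

/-- `d` is the minimal depth of the (nonempty) words of `Y`. -/
def IsMinimalDepth (d : ℕ∞) : Prop :=
  IsLeast {c | ∃ w ∈ language Y, w ≠ [] ∧ c = π.depth w} d

/-- `d` is the minimal t-depth of the (nonempty) words of `Y`. -/
def IsMinimalTDepth (d : ℕ∞) : Prop :=
  IsLeast {c | ∃ w ∈ language Y, w ≠ [] ∧ c = π.tDepth w} d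

end FactorCode

end ClassDegree

/-! By the 1-step property, points can be spliced wherever they share a symbol. So `x` has a right
transition to `x'` over the same image iff, from every coordinate on, a finite path over the image
leads from `x` to `x'` (`rightTransition_iff`). Hence finitely many pairwise inequivalent points
over `y` are not two-way connected on any interval far enough to the right (`exists_threshold`).

For the equivalences, every nonempty word `w` of `Y` satisfies class degree ≤ t-depth ≤ depth, and
some word has depth at most the class degree. The first inequality uses a periodic point whose image
repeats `w`: on far copies of `w` the pigeonhole principle connects two of any `τ(w) + 1` points.
The second holds because words routed through the same symbol are tangled. The last fact is
compactness: if no central word of `y` were routable through class representatives, some limit point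
over `y` would lie in no class (`exists_routableThrough`). Compactness of `Y` makes the word length
uniform when all class counts are bounded. Conversely, a uniform t-depth bounds every class count.

For the closing properties, every interval carries `d` paths that are pairwise not two-way connected
(`exists_separated`), while a window of length `N` has room for no more. A path on such a window is
therefore attached to one of the `d` separated paths and can be continued along it, which gives
bi-continuing. For class-closing, a periodic point visits both `x` and `x'`, and representatives
through it give two separated systems, matched by a permutation `φ` on the left and `ψ` on the
right. The composite `ψ⁻¹φ` moves representatives along right transitions, so having finite order it
is trivial. Agreement of `x` and `x'` on one side fixes their common index there, hence also on the
other side (`exists_twoWay_of_asymptotic`). -/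

namespace ClassDegree

/-! ### Splicing, recurrence and periodic points in a 1-step shift of finite type. -/

section Points

variable {A : Type*}

@[simp]
lemma block_length (x : ℤ → A) (i : ℤ) (l : ℕ) : (block x i l).length = l := by
  simp [block]

lemma getElem?_block (x : ℤ → A) (i : ℤ) {l k : ℕ} (hk : k < l) :
    (block x i l)[k]? = some (x (i + k)) := by
  simp [block, hk]

lemma block_eq_block_iff {x y : ℤ → A} {i j : ℤ} {l : ℕ} :
    block x i l = block y j l ↔ ∀ k : ℕ, k < l → x (i + k) = y (j + k) := by
  simp only [block, List.ofFn_inj, funext_iff, Fin.forall_iff]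

lemma block_add (x : ℤ → A) (i : ℤ) (l l' : ℕ) :
    block x i (l + l') = block x i l ++ block x (i + l) l' := by
  simp only [block, List.ofFn_add]
  congr 2
  funext k
  simp [add_assoc]

lemma head?_block (x : ℤ → A) (i : ℤ) {l : ℕ} (hl : 0 < l) :
    (block x i l).head? = some (x i) := by
  rw [List.head?_eq_getElem?, getElem?_block x i hl]
  simp

lemma getLast?_block (x : ℤ → A) (i : ℤ) {l : ℕ} (hl : 0 < l) :
    (block x i l).getLast? = some (x (i + l - 1)) := by
  rw [List.getLast?_eq_getElem?, block_length, getElem?_block x i (by omega)]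
  congr 2
  omega

lemma apply_add_mul_of_periodic {q : ℤ → A} {L : ℤ} (hq : ∀ i, q (i + L) = q i) (i : ℤ) (h : ℕ) :
    q (i + h * L) = q i := by
  induction h with
  | zero => simp
  | succ h ih => rw [← ih, ← hq (i + h * L)]; congr 1; push_cast; ring

variable [TopologicalSpace A] {X : Subshift A ℤ}

lemma block_mem_language (x : X.carrier) (i : ℤ) (l : ℕ) : block x.1 i l ∈ language X :=
  ⟨x.1, x.2, i, by simp⟩

/-- The point `x` shifted by `t` coordinates to the left. -/
def translate (t : ℤ) (x : X.carrier) : X.carrier := ⟨shift t x.1, X.mapsTo t x.2⟩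

@[simp]
lemma translate_apply (t : ℤ) (x : X.carrier) (i : ℤ) : (translate t x).1 i = x.1 (t + i) := rfl

lemma translate_translate (s t : ℤ) (x : X.carrier) :
    translate s (translate t x) = translate (t + s) x := by
  ext i
  simp [add_assoc]

@[simp]
lemma translate_zero (x : X.carrier) : translate 0 x = x := by
  ext i
  simp

/-- A sequence all of whose finite parts occur in `X` belongs to `X`. -/
lemma mem_of_forall_agree {x : ℤ → A}
    (h : ∀ K : ℕ, ∃ z ∈ X.carrier, ∀ i : ℤ, |i| ≤ K → z i = x i) : x ∈ X.carrier := by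
  choose z hz hzx using h
  refine X.isClosed.mem_of_tendsto (f := z) (b := Filter.atTop) ?_ (.of_forall hz)
  rw [tendsto_pi_nhds]
  intro i
  refine tendsto_const_nhds.congr' ?_
  filter_upwards [Filter.eventually_ge_atTop i.natAbs] with K hK
  exact (hzx K i (by rw [Int.abs_eq_natAbs]; exact_mod_cast hK)).symm

/-- `x` up to the coordinate `m`, followed by `x'`. -/
def spliceFun (m : ℤ) (x x' : ℤ → A) : ℤ → A := fun i => if i ≤ m then x i else x' i

/-- The symbol at `m` is a synchronizing word, so every finite block around the seam occurs in `X`;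
closedness does the rest. -/
lemma spliceFun_mem (hstep : IsStepSFT 1 X) (m : ℤ) (x x' : X.carrier) (h : x.1 m = x'.1 m) :
    spliceFun m x.1 x'.1 ∈ X.carrier := by
  refine mem_of_forall_agree fun K => ?_
  set s := spliceFun m x.1 x'.1 with hs
  obtain ⟨n, hn⟩ : ∃ n : ℕ, |m| + K ≤ n := ⟨(|m| + K).toNat, by omega⟩
  have hl : block s (m - n) (n + 1) = block x.1 (m - n) (n + 1) := by
    rw [block_eq_block_iff]
    intro k hk
    have : m - n + (k : ℤ) ≤ m := by omega
    simp [hs, spliceFun, this]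
  have hr : block s m (1 + n) = block x'.1 m (1 + n) := by
    rw [block_eq_block_iff]
    intro k hk
    rcases Nat.eq_zero_or_pos k with rfl | hk0
    · simpa [hs, spliceFun] using h
    · have : ¬ m + (k : ℤ) ≤ m := by omega
      simp [hs, spliceFun, this]
  have h1 : block s m 1 ∈ language X := by
    have : block s m 1 = block x.1 m 1 := by
      rw [block_eq_block_iff]
      intro k hk
      obtain rfl : k = 0 := by omega
      simp [hs, spliceFun]
    rw [this]
    exact block_mem_language x m 1
  have key := hstep _ h1 (by simp) (block s (m - n) n) (block s (m + 1) n)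
    (by
      have := block_add s (m - n) n 1
      rw [hl, sub_add_cancel] at this
      rw [← this]
      exact block_mem_language x _ _)
    (by
      have := block_add s m 1 n
      rw [hr, Nat.cast_one] at this
      rw [← this]
      exact block_mem_language x' _ _)
  have e : block s (m - n) n ++ block s m 1 ++ block s (m + 1) n = block s (m - n) (n + 1 + n) := by
    rw [block_add, block_add]
    congr 2
    · simp
    · push_cast
      ring
  rw [e] at key
  obtain ⟨z, hz, i, hzi⟩ := key
  rw [block_length, block_eq_block_iff] at hzi
  refine ⟨(translate (i - (m - n)) (⟨z, hz⟩ : X.carrier)).1, (translate _ _).2, fun j hj => ?_⟩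
  have := hzi (j - (m - n)).toNat (by rw [abs_le] at hj; have := abs_le.1 (le_refl |m|); omega)
  rw [translate_apply]
  convert this.symm using 2 <;> rw [abs_le] at hj <;> have := abs_le.1 (le_refl |m|) <;> omega

/-- The point that is `x` up to the coordinate `m`, followed by `x'`. -/
def splice (hstep : IsStepSFT 1 X) (m : ℤ) (x x' : X.carrier) (h : x.1 m = x'.1 m) : X.carrier :=
  ⟨spliceFun m x.1 x'.1, spliceFun_mem hstep m x x' h⟩

lemma splice_of_le (hstep : IsStepSFT 1 X) {m : ℤ} {x x' : X.carrier} (h : x.1 m = x'.1 m)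
    {i : ℤ} (hi : i ≤ m) : (splice hstep m x x' h).1 i = x.1 i := by
  simp [splice, spliceFun, hi]

lemma splice_of_ge (hstep : IsStepSFT 1 X) {m : ℤ} {x x' : X.carrier} (h : x.1 m = x'.1 m)
    {i : ℤ} (hi : m ≤ i) : (splice hstep m x x' h).1 i = x'.1 i := by
  rcases hi.eq_or_lt with rfl | hi
  · simpa [splice, spliceFun] using h
  · simp [splice, spliceFun, not_le.2 hi]

/-- A 1-step shift is determined by its admissible two-symbol blocks: these are glued one symbol at
a time with `splice`. -/
lemma mem_of_local (hstep : IsStepSFT 1 X) {x : ℤ → A}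
    (h : ∀ j : ℤ, ∃ z : X.carrier, z.1 j = x j ∧ z.1 (j + 1) = x (j + 1)) : x ∈ X.carrier := by
  have key : ∀ (j : ℤ) (n : ℕ), ∃ z : X.carrier, ∀ i, j ≤ i → i ≤ j + n → z.1 i = x i := by
    intro j n
    induction n with
    | zero =>
      obtain ⟨z, hz, -⟩ := h j
      refine ⟨z, fun i hi hi' => ?_⟩
      obtain rfl : i = j := by simp at hi'; omega
      exact hz
    | succ n ih =>
      obtain ⟨z, hz⟩ := ih
      obtain ⟨z', hz1, hz2⟩ := h (j + n)
      have e : z.1 (j + n) = z'.1 (j + n) := by rw [hz1, hz _ (by omega) le_rfl]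
      refine ⟨splice hstep (j + n) z z' e, fun i hi hi' => ?_⟩
      rcases le_or_gt i (j + n) with hin | hin
      · rw [splice_of_le hstep e hin, hz i hi hin]
      · obtain rfl : i = j + n + 1 := by push_cast at hi'; omega
        rw [splice_of_ge hstep e hin.le, hz2]
  refine mem_of_forall_agree fun K => ?_
  obtain ⟨z, hz⟩ := key (-K) (2 * K)
  exact ⟨z.1, z.2, fun i hi => hz i (by rw [abs_le] at hi; omega)
    (by rw [abs_le] at hi; push_cast; omega)⟩

/-- In an irreducible subshift a point can be found that agrees with `x` on an interval and
with a translate of `x'` on a later copy of that interval. -/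
lemma IsIrreducible.exists_visit (hirr : IsIrreducible X) (x x' : X.carrier) (a b : ℤ) :
    ∃ (z : X.carrier) (t : ℤ), b < a + t ∧ (∀ i, a ≤ i → i ≤ b → z.1 i = x.1 i) ∧
      ∀ i, a ≤ i → i ≤ b → z.1 (i + t) = x'.1 i := by
  set l : ℕ := (b - a + 1).toNat with hl
  obtain ⟨w, z, hz, i, hzi⟩ := hirr _ (block_mem_language x a l) _ (block_mem_language x' a l)
  have hget : ∀ k : ℕ, k < l + w.length + l →
      (block x.1 a l ++ w ++ block x'.1 a l)[k]? = some (z (i + k)) := by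
    intro k hk
    rw [hzi, getElem?_block _ _ (by simpa [add_assoc] using hk)]
  refine ⟨translate (i - a) (⟨z, hz⟩ : X.carrier), l + w.length, by omega, fun j hj hj' => ?_,
    fun j hj hj' => ?_⟩
  · have := hget (j - a).toNat (by omega)
    rw [List.getElem?_append_left (by simp; omega), List.getElem?_append_left (by simp; omega),
      getElem?_block _ _ (by omega), Option.some_inj] at this
    rw [translate_apply]
    convert this.symm using 2 <;> omega
  · have := hget (l + w.length + (j - a).toNat) (by omega)
    rw [List.getElem?_append_right (by simp), List.length_append, block_length,
      Nat.add_sub_cancel_left, getElem?_block _ _ (by omega), Option.some_inj] at this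
    rw [translate_apply]
    convert this.symm using 2 <;> push_cast <;> omega

lemma exists_periodic (hirr : IsIrreducible X) (hstep : IsStepSFT 1 X) (x : X.carrier) {a b : ℤ}
    (hab : a ≤ b) : ∃ (q : X.carrier) (L : ℤ), 0 < L ∧ (∀ i, q.1 (i + L) = q.1 i) ∧
      ∀ i, a ≤ i → i ≤ b → q.1 i = x.1 i := by
  obtain ⟨z, t, hbt, hz, hz'⟩ := hirr.exists_visit x x a b
  have ht : 0 < t := by omega
  -- Since `z` returns to its word on `[a, b]` after `t` steps, `z (a + t) = z a`, and the block on
  -- `[a, a + t)` can be repeated without a bad seam.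
  refine ⟨⟨fun i => z.1 (a + (i - a) % t), mem_of_local hstep fun j => ?_⟩, t, ht, fun i => ?_,
    fun i hi hi' => ?_⟩
  · have h0 := Int.emod_nonneg (j - a) ht.ne'
    have h1 := Int.emod_lt_of_pos (j - a) ht
    have h2 := Int.emod_add_mul_ediv (j - a) t
    refine ⟨translate (a + (j - a) % t - j) z, ?_, ?_⟩
    · simp
    · rw [translate_apply]
      rcases lt_or_ge ((j - a) % t + 1) t with h3 | h3
      · have : (j + 1 - a) % t = (j - a) % t + 1 := by
          rw [show j + 1 - a = ((j - a) % t + 1) + t * ((j - a) / t) by omega,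
            Int.add_mul_emod_self_left, Int.emod_eq_of_lt (by omega) h3]
        simp only [this]
        exact congrArg z.1 (by ring)
      · have h4 : (j - a) % t + 1 = t := by omega
        have : (j + 1 - a) % t = 0 := by
          rw [show j + 1 - a = t + t * ((j - a) / t) by omega,
            Int.add_mul_emod_self_left, Int.emod_self]
        simp only [this, add_zero]
        rw [show a + (j - a) % t - j + (j + 1) = a + t by omega, hz' a le_rfl hab, hz a le_rfl hab]
  · simp only
    rw [show i + t - a = (i - a) + t by omega, Int.add_emod_right]
  · simp only
    rw [Int.emod_eq_of_lt (by omega) (by omega), add_sub_cancel, hz i hi hi']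

/-- A point that visits the interval `[a, b]` of both `x` and `x'` periodically. -/
lemma exists_periodic_visit (hirr : IsIrreducible X) (hstep : IsStepSFT 1 X) (x x' : X.carrier)
    {a b : ℤ} (hab : a ≤ b) : ∃ (q : X.carrier) (L t : ℤ), 0 < L ∧
      (∀ i, a ≤ i → i ≤ b → ∀ h : ℕ, q.1 (i + h * L) = x.1 i) ∧
      ∀ i, a ≤ i → i ≤ b → ∀ h : ℕ, q.1 (i + (t + h * L)) = x'.1 i := by
  obtain ⟨z, t, hbt, hz, hz'⟩ := hirr.exists_visit x x' a b
  obtain ⟨q, L, hL, hq, hqz⟩ := exists_periodic hirr hstep z (a := a) (b := b + t) (by omega)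
  refine ⟨q, L, t, hL, fun i hi hi' h => ?_, fun i hi hi' h => ?_⟩
  · rw [apply_add_mul_of_periodic hq, hqz i hi (by omega), hz i hi hi']
  · rw [← add_assoc, apply_add_mul_of_periodic hq, hqz _ (by omega) (by omega), hz' i hi hi']

lemma language_iff {w : List A} :
    w ∈ language X ↔ ∃ (x : X.carrier) (i : ℤ), w = block x.1 i w.length :=
  ⟨fun ⟨x, hx, i, h⟩ => ⟨⟨x, hx⟩, i, h⟩, fun ⟨x, i, h⟩ => ⟨x.1, x.2, i, h⟩⟩

end Points

end ClassDegree

/-! ### Paths over a sequence, and transition classes. -/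

namespace ClassDegree

namespace FactorCode

variable {A B : Type*} [TopologicalSpace A] [TopologicalSpace B]
  {X : Subshift A ℤ} {Y : Subshift B ℤ} {π : FactorCode X Y}

variable (π) in
lemma map_translate (t : ℤ) (x : X.carrier) :
    π.toFun (translate t x) = translate t (π.toFun x) := by
  have h1 : ∀ x : X.carrier, π.toFun (translate 1 x) = translate 1 (π.toFun x) :=
    fun x => Subtype.ext (π.map_shift x)
  have hpos : ∀ (n : ℕ) (x : X.carrier), π.toFun (translate n x) = translate n (π.toFun x) := by
    intro n x
    induction n with
    | zero => simp
    | succ n ih =>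
      push_cast
      rw [← translate_translate, h1, ih, translate_translate]
  rcases Int.eq_nat_or_neg t with ⟨n, rfl | rfl⟩
  · exact hpos n x
  · have := hpos n (translate (-n) x)
    rw [translate_translate, neg_add_cancel, translate_zero] at this
    rw [this, translate_translate, add_neg_cancel, translate_zero]

variable (π) in
lemma map_translate_apply (t : ℤ) (x : X.carrier) (i : ℤ) :
    (π.toFun (translate t x)).1 i = (π.toFun x).1 (t + i) := by
  rw [map_translate, translate_apply]

lemma IsOneBlock.map_eq (hπ : π.IsOneBlock) {x x' : X.carrier} {i j : ℤ} (h : x.1 i = x'.1 j) :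
    (π.toFun x).1 i = (π.toFun x').1 j := by
  have := hπ (translate i x) (translate j x') (by simpa using h)
  simpa [map_translate_apply] using this

variable (π) in
/-- The image of `x` agrees with `y` on the interval `[m, n]`. -/
def IsOver (y : ℤ → B) (m n : ℤ) (x : X.carrier) : Prop :=
  ∀ k, m ≤ k → k ≤ n → (π.toFun x).1 k = y k

variable (π) in
/-- Some path over `y` leads from the symbol `a` at `m` to the symbol `b` at `n`. -/
def Conn (y : ℤ → B) (m n : ℤ) (a b : A) : Prop :=
  ∃ z : X.carrier, z.1 m = a ∧ z.1 n = b ∧ π.IsOver y m n z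

variable (π) in
/-- There are bridges over `y` on `[m, n]` from `x` to `x'` and from `x'` to `x`. -/
def TwoWay (y : ℤ → B) (m n : ℤ) (x x' : ℤ → A) : Prop :=
  π.Conn y m n (x m) (x' n) ∧ π.Conn y m n (x' m) (x n)

lemma IsOver.mono {y : ℤ → B} {m n m' n' : ℤ} {x : X.carrier} (h : π.IsOver y m n x)
    (hm : m ≤ m') (hn : n' ≤ n) : π.IsOver y m' n' x :=
  fun k hk hk' => h k (hm.trans hk) (hk'.trans hn)

lemma isOver_of_eq {x : X.carrier} {y : Y.carrier} (h : π.toFun x = y) (m n : ℤ) :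
    π.IsOver y.1 m n x := fun k _ _ => by rw [h]

lemma IsOver.conn {y : ℤ → B} {m n : ℤ} {x : X.carrier} (h : π.IsOver y m n x) :
    π.Conn y m n (x.1 m) (x.1 n) := ⟨x, rfl, rfl, h⟩

lemma IsOver.splice (hstep : IsStepSFT 1 X) (hπ : π.IsOneBlock) {y : ℤ → B} {m n k : ℤ}
    {x x' : X.carrier} (hx : π.IsOver y m n x) (hx' : π.IsOver y n k x') (h : x.1 n = x'.1 n) :
    π.IsOver y m k (splice hstep n x x' h) := by
  intro i hi hi'
  rcases le_total i n with hin | hin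
  · rw [hπ.map_eq (splice_of_le hstep h hin), hx i hi hin]
  · rw [hπ.map_eq (splice_of_ge hstep h hin), hx' i hin hi']

lemma Conn.trans (hstep : IsStepSFT 1 X) (hπ : π.IsOneBlock) {y : ℤ → B} {m n k : ℤ} {a b c : A}
    (hmn : m ≤ n) (hnk : n ≤ k) (h : π.Conn y m n a b) (h' : π.Conn y n k b c) :
    π.Conn y m k a c := by
  obtain ⟨z, hz, hzb, hzy⟩ := h
  obtain ⟨z', hz', hzc, hzy'⟩ := h'
  have e : z.1 n = z'.1 n := hzb.trans hz'.symm
  exact ⟨ClassDegree.splice hstep n z z' e, (splice_of_le hstep e hmn).trans hz,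
    (splice_of_ge hstep e hnk).trans hzc, hzy.splice hstep hπ hzy' e⟩

lemma IsOver.translate {y y' : ℤ → B} {m n : ℤ} (t : ℤ) {x : X.carrier} (h : π.IsOver y m n x)
    (hy : ∀ k, m ≤ k → k ≤ n → y' (k + t) = y k) :
    π.IsOver y' (m + t) (n + t) (translate (-t) x) := by
  intro k hk hk'
  rw [map_translate_apply, h _ (by omega) (by omega), ← hy _ (by omega) (by omega)]
  congr 1
  ring

lemma Conn.translate {y y' : ℤ → B} {m n : ℤ} {a b : A} (t : ℤ) (h : π.Conn y m n a b)
    (hy : ∀ k, m ≤ k → k ≤ n → y' (k + t) = y k) : π.Conn y' (m + t) (n + t) a b := by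
  obtain ⟨z, rfl, rfl, hz⟩ := h
  exact ⟨ClassDegree.translate (-t) z, by simp, by simp, hz.translate t hy⟩

lemma Conn.congr {y y' : ℤ → B} {m n : ℤ} {a b : A} (h : π.Conn y m n a b)
    (hy : ∀ k, m ≤ k → k ≤ n → y' k = y k) : π.Conn y' m n a b := by
  simpa using h.translate 0 (y' := y') (by simpa using hy)

lemma Conn.extend (hstep : IsStepSFT 1 X) (hπ : π.IsOneBlock) {y : ℤ → B} {m n m' n' : ℤ}
    {x x' : X.carrier} (hm : m' ≤ m) (hmn : m ≤ n) (hn : n ≤ n') (h : π.Conn y m n (x.1 m) (x'.1 n))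
    (hx : π.IsOver y m' m x) (hx' : π.IsOver y n n' x') : π.Conn y m' n' (x.1 m') (x'.1 n') :=
  (hx.conn.trans hstep hπ hm hmn h).trans hstep hπ (hm.trans hmn) hn hx'.conn

lemma TwoWay.symm {y : ℤ → B} {m n : ℤ} {x x' : ℤ → A} (h : π.TwoWay y m n x x') :
    π.TwoWay y m n x' x := ⟨h.2, h.1⟩

lemma TwoWay.extend (hstep : IsStepSFT 1 X) (hπ : π.IsOneBlock) {y : ℤ → B} {m n m' n' : ℤ}
    {x x' : X.carrier} (hm : m' ≤ m) (hmn : m ≤ n) (hn : n ≤ n') (h : π.TwoWay y m n x.1 x'.1)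
    (hx : π.IsOver y m' n' x) (hx' : π.IsOver y m' n' x') : π.TwoWay y m' n' x.1 x'.1 :=
  ⟨h.1.extend hstep hπ hm hmn hn (hx.mono le_rfl (hmn.trans hn)) (hx'.mono (hm.trans hmn) le_rfl),
    h.2.extend hstep hπ hm hmn hn (hx'.mono le_rfl (hmn.trans hn)) (hx.mono (hm.trans hmn) le_rfl)⟩

/-- A finite path from `x m` to `x' n` becomes a bridge after splicing on the left tail of `x` and
the right tail of `x'`. -/
lemma rightTransition_iff (hstep : IsStepSFT 1 X) (hπ : π.IsOneBlock) {x x' : X.carrier} :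
    π.RightTransition x x' ↔ π.toFun x = π.toFun x' ∧
      ∀ m : ℤ, ∃ n > m, π.Conn (π.toFun x).1 m n (x.1 m) (x'.1 n) := by
  constructor
  · intro h
    refine ⟨(h 0).choose_spec.1, fun m => ?_⟩
    obtain ⟨z, -, hzx, hm, n, hn, hzn⟩ := h m
    exact ⟨n, hn, z, hm m le_rfl, hzn n le_rfl, isOver_of_eq hzx _ _⟩
  · rintro ⟨he, h⟩ m
    obtain ⟨n, hn, z, hzm, hzn, hz⟩ := h m
    have e2 : (splice hstep m x z hzm.symm).1 n = x'.1 n := by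
      rw [splice_of_ge hstep _ hn.le, hzn]
    have hov : ∀ k, π.IsOver (π.toFun x).1 (m - k) (n + k)
        (splice hstep n (splice hstep m x z hzm.symm) x' e2) := fun k =>
      ((isOver_of_eq rfl _ _).splice hstep hπ hz _).splice hstep hπ
        (isOver_of_eq he.symm _ _) _
    refine ⟨splice hstep n (splice hstep m x z hzm.symm) x' e2, he, ?_, fun i hi => ?_, n, hn,
      fun i hi => splice_of_ge hstep _ hi⟩
    · ext i
      exact hov (|m - i| + |i - n|) i (by linarith [le_abs_self (m - i), abs_nonneg (i - n)])
        (by linarith [le_abs_self (i - n), abs_nonneg (m - i)])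
    · rw [splice_of_le hstep _ (hi.trans hn.le), splice_of_le hstep _ hi]

/-- One direction suffices: left transitions occur only in the conclusion of the theorem, the
classes being counted by right transitions. -/
lemma leftTransition_of_conn (hstep : IsStepSFT 1 X) (hπ : π.IsOneBlock) {x x' : X.carrier}
    (he : π.toFun x = π.toFun x')
    (h : ∀ m : ℤ, ∃ n < m, π.Conn (π.toFun x).1 n m (x'.1 n) (x.1 m)) :
    π.LeftTransition x x' := by
  intro m
  obtain ⟨n, hn, z, hzn, hzm, hz⟩ := h m
  have e2 : (splice hstep n x' z hzn.symm).1 m = x.1 m := by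
    rw [splice_of_ge hstep _ hn.le, hzm]
  have hov : ∀ k, π.IsOver (π.toFun x).1 (n - k) (m + k)
      (splice hstep m (splice hstep n x' z hzn.symm) x e2) := fun k =>
    ((isOver_of_eq he.symm _ _).splice hstep hπ hz _).splice hstep hπ
      (isOver_of_eq rfl _ _) _
  refine ⟨splice hstep m (splice hstep n x' z hzn.symm) x e2, he, ?_,
    fun i hi => splice_of_ge hstep _ hi, n, hn, fun i hi => ?_⟩
  · ext i
    exact hov (|n - i| + |i - m|) i (by linarith [le_abs_self (n - i), abs_nonneg (i - m)])
      (by linarith [le_abs_self (i - m), abs_nonneg (n - i)])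
  · rw [splice_of_le hstep _ (hi.trans hn.le), splice_of_le hstep _ hi]

lemma RightTransition.map_eq {x x' : X.carrier} (h : π.RightTransition x x') :
    π.toFun x = π.toFun x' := (h 0).choose_spec.1

variable (π) in
lemma rightTransition_refl (x : X.carrier) : π.RightTransition x x :=
  fun m => ⟨x, rfl, rfl, fun _ _ => rfl, m + 1, by simp, fun _ _ => rfl⟩

lemma RightTransition.trans (hstep : IsStepSFT 1 X) (hπ : π.IsOneBlock) {x x' x'' : X.carrier}
    (h : π.RightTransition x x') (h' : π.RightTransition x' x'') : π.RightTransition x x'' := by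
  have he := h.map_eq
  rw [rightTransition_iff hstep hπ] at *
  refine ⟨he.trans h'.1, fun m => ?_⟩
  obtain ⟨n, hn, h1⟩ := h.2 m
  obtain ⟨k, hk, h2⟩ := h'.2 n
  rw [← he] at h2
  exact ⟨k, hn.trans hk, h1.trans hstep hπ hn.le hk.le h2⟩

lemma RightEquiv.symm {x x' : X.carrier} (h : π.RightEquiv x x') : π.RightEquiv x' x :=
  ⟨h.2, h.1⟩

lemma RightEquiv.trans (hstep : IsStepSFT 1 X) (hπ : π.IsOneBlock) {x x' x'' : X.carrier}
    (h : π.RightEquiv x x') (h' : π.RightEquiv x' x'') : π.RightEquiv x x'' :=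
  ⟨h.1.trans hstep hπ h'.1, h'.2.trans hstep hπ h.2⟩

lemma rightClass_eq_iff (hstep : IsStepSFT 1 X) (hπ : π.IsOneBlock) {x x' : X.carrier} :
    π.rightClass x = π.rightClass x' ↔ π.RightEquiv x x' := by
  constructor
  · intro h
    have : x' ∈ π.rightClass x' := ⟨π.rightTransition_refl x', π.rightTransition_refl x'⟩
    rw [← h] at this
    exact this
  · intro h
    ext z
    exact ⟨fun hz => h.symm.trans hstep hπ hz, fun hz => h.trans hstep hπ hz⟩

/-- Over far right intervals, pairwise inequivalent points are not connected both ways. -/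
lemma exists_threshold (hstep : IsStepSFT 1 X) (hπ : π.IsOneBlock) {ι : Type*} [Finite ι]
    {p : ι → X.carrier} {y : Y.carrier} (hp : ∀ i, π.toFun (p i) = y)
    (hne : ∀ i j, π.RightEquiv (p i) (p j) → i = j) :
    ∃ R : ℤ, ∀ m ≥ R, ∀ n ≥ m, ∀ i j, π.TwoWay y.1 m n (p i).1 (p j).1 → i = j := by
  have key : ∀ i j, ∃ R : ℤ, ∀ m ≥ R, ∀ n ≥ m, π.TwoWay y.1 m n (p i).1 (p j).1 → i = j := by
    intro i j
    by_contra! hcon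
    have hij : i ≠ j := by
      obtain ⟨m, -, n, -, -, h⟩ := hcon 0
      exact h
    -- Two-way connections exist arbitrarily far to the right; prolonging them back to any `m` gives
    -- right transitions both ways.
    refine hij (hne i j ⟨?_, ?_⟩) <;> rw [rightTransition_iff hstep hπ] <;>
      refine ⟨by rw [hp, hp], fun m => ?_⟩ <;> rw [hp] <;>
      obtain ⟨m', hm', n, hn, h, -⟩ := hcon (m + 1) <;> refine ⟨n, by omega, ?_⟩
    · exact h.1.extend hstep hπ (by omega) hn le_rfl (isOver_of_eq (hp i) _ _)
        (isOver_of_eq (hp j) _ _)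
    · exact h.2.extend hstep hπ (by omega) hn le_rfl (isOver_of_eq (hp j) _ _)
        (isOver_of_eq (hp i) _ _)
  choose R hR using key
  obtain ⟨M, hM⟩ := (Set.finite_range fun ij : ι × ι => R ij.1 ij.2).bddAbove
  exact ⟨M, fun m hm n hn i j h => hR i j m ((hM ⟨(i, j), rfl⟩).trans hm) n hn h⟩

lemma exists_inequivalent_of_le (hstep : IsStepSFT 1 X) (hπ : π.IsOneBlock) {y : Y.carrier} {k : ℕ}
    (hk : k ≤ π.rightClassCount y) : ∃ p : Fin k → X.carrier, (∀ i, π.toFun (p i) = y) ∧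
      ∀ i j, π.RightEquiv (p i) (p j) → i = j := by
  obtain ⟨T, hT, hTk⟩ := Set.exists_subset_encard_eq hk
  have hfin : T.Finite := Set.finite_of_encard_eq_coe hTk
  have hcard : Nat.card T = k := by
    rw [Nat.card_coe_set_eq, Set.ncard_def, hTk]
    rfl
  have : Finite T := hfin
  let e : Fin k ≃ T := (Finite.equivFinOfCardEq hcard).symm
  choose p hp hpc using fun i => hT (e i).2
  refine ⟨p, hp, fun i j hij => e.injective (Subtype.ext ?_)⟩
  rw [hpc, hpc, rightClass_eq_iff hstep hπ]
  exact hij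

lemma exists_representatives (hstep : IsStepSFT 1 X) (hπ : π.IsOneBlock) {y : Y.carrier} {k : ℕ}
    (hk : π.rightClassCount y = k) : ∃ p : Fin k → X.carrier, (∀ i, π.toFun (p i) = y) ∧
      (∀ i j, π.RightEquiv (p i) (p j) → i = j) ∧
      ∀ x, π.toFun x = y → ∃ i, π.RightEquiv x (p i) := by
  obtain ⟨p, hp, hpe⟩ := exists_inequivalent_of_le hstep hπ hk.ge
  refine ⟨p, hp, hpe, fun x hx => ?_⟩
  have hinj : Function.Injective fun i => π.rightClass (p i) := fun i j hij =>
    hpe i j ((rightClass_eq_iff hstep hπ).1 hij)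
  -- The `p i` have `k` distinct classes inside a set of cardinality `k`, hence all of them.
  have hr : Set.range (fun i => π.rightClass (p i)) = π.rightClasses y := by
    refine (Set.finite_range _).eq_of_subset_of_encard_le ?_ ?_
    · rintro _ ⟨i, rfl⟩
      exact ⟨p i, hp i, rfl⟩
    · rw [← Set.image_univ, hinj.encard_image, Set.encard_univ]
      simpa [rightClassCount] using hk.le
  have hx' : π.rightClass x ∈ π.rightClasses y := ⟨x, hx, rfl⟩
  rw [← hr] at hx'
  obtain ⟨i, hi⟩ := hx'
  exact ⟨i, (rightClass_eq_iff hstep hπ).1 hi.symm⟩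

/-- Any point over `y` belongs to a system of representatives of the classes over `y`. -/
lemma exists_representatives_through (hstep : IsStepSFT 1 X) (hπ : π.IsOneBlock) {k : ℕ}
    (q : X.carrier) (hk : π.rightClassCount (π.toFun q) = k) :
    ∃ (p : Fin k → X.carrier) (i₀ : Fin k), p i₀ = q ∧ (∀ i, π.toFun (p i) = π.toFun q) ∧
      ∀ i j, π.RightEquiv (p i) (p j) → i = j := by
  obtain ⟨p, hp, hpe, hall⟩ := exists_representatives hstep hπ hk
  obtain ⟨i₀, hi₀⟩ := hall q rfl
  have hu : ∀ i, π.RightEquiv (Function.update p i₀ q i) (p i) := by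
    intro i
    rcases eq_or_ne i i₀ with rfl | hi
    · simpa using hi₀
    · rw [Function.update_of_ne hi]
      exact ⟨π.rightTransition_refl _, π.rightTransition_refl _⟩
  refine ⟨Function.update p i₀ q, i₀, by simp, fun i => ?_, fun i j hij => ?_⟩
  · rw [(hu i).1.map_eq, hp]
  · exact hpe i j (((hu i).symm.trans hstep hπ hij).trans hstep hπ (hu j))

end FactorCode

end ClassDegree

/-! ### Depth and t-depth in terms of paths on intervals. -/

namespace ClassDegree

namespace FactorCode

variable {A B : Type*} [TopologicalSpace A] [TopologicalSpace B]
  {X : Subshift A ℤ} {Y : Subshift B ℤ} {π : FactorCode X Y}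

lemma mem_wordFiber_block {y : ℤ → B} {m : ℤ} {l : ℕ} {u : List A} :
    u ∈ π.wordFiber (block y m l) ↔
      ∃ x : X.carrier, u = block x.1 m l ∧ π.IsOver y m (m + l - 1) x := by
  simp only [wordFiber, Set.mem_ofPred_eq, block_length]
  constructor
  · rintro ⟨x, i, rfl, h⟩
    rw [block_eq_block_iff] at h
    refine ⟨translate (i - m) x, ?_, fun k hk hk' => ?_⟩
    · rw [block_eq_block_iff]
      intro k hk
      exact congrArg x.1 (by ring)
    · have := h (k - m).toNat (by omega)
      rw [map_translate_apply]
      convert this.symm using 2 <;> omega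
  · rintro ⟨x, rfl, h⟩
    refine ⟨x, m, rfl, ?_⟩
    rw [block_eq_block_iff]
    intro k hk
    exact (h _ (by omega) (by omega)).symm

lemma exists_isBridge_iff {y : ℤ → B} {m : ℤ} {l : ℕ} (hl : 0 < l) {x x' : X.carrier} :
    (∃ v, π.IsBridge (block y m l) (block x.1 m l) (block x'.1 m l) v) ↔
      π.Conn y m (m + l - 1) (x.1 m) (x'.1 (m + l - 1)) := by
  simp only [IsBridge, mem_wordFiber_block]
  constructor
  · rintro ⟨_, ⟨z, rfl, hz⟩, h1, h2⟩
    rw [head?_block _ _ hl, head?_block _ _ hl, Option.some_inj] at h1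
    rw [getLast?_block _ _ hl, getLast?_block _ _ hl, Option.some_inj] at h2
    exact ⟨z, h1, h2, hz⟩
  · rintro ⟨z, h1, h2, hz⟩
    refine ⟨_, ⟨z, rfl, hz⟩, ?_, ?_⟩
    · rw [head?_block _ _ hl, head?_block _ _ hl, h1]
    · rw [getLast?_block _ _ hl, getLast?_block _ _ hl, h2]

/-- A path to `a` and a path from `a` can be spliced, so the two halves of a route may be chosen
independently. -/
lemma isRoutable_iff (hstep : IsStepSFT 1 X) (hπ : π.IsOneBlock) {y : ℤ → B} {m : ℤ} {l n : ℕ}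
    (hn : n < l) {x : X.carrier} {M : Set A} :
    π.IsRoutable (block y m l) (block x.1 m l) M n ↔
      ∃ a ∈ M, π.Conn y m (m + n) (x.1 m) a ∧
        π.Conn y (m + n) (m + l - 1) a (x.1 (m + l - 1)) := by
  have hl : 0 < l := by omega
  simp only [IsRoutable, mem_wordFiber_block]
  constructor
  · rintro ⟨_, ⟨z, rfl, hz⟩, h1, h2, a, ha, h3⟩
    rw [head?_block _ _ hl, head?_block _ _ hl, Option.some_inj] at h1
    rw [getLast?_block _ _ hl, getLast?_block _ _ hl, Option.some_inj] at h2
    rw [getElem?_block _ _ hn, Option.some_inj] at h3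
    exact ⟨a, ha, ⟨z, h1, h3, hz.mono le_rfl (by omega)⟩, z, h3, h2, hz.mono (by omega) le_rfl⟩
  · rintro ⟨a, ha, ⟨z, h1, h2, hz⟩, z', h1', h2', hz'⟩
    have e : z.1 (m + n) = z'.1 (m + n) := h2.trans h1'.symm
    refine ⟨_, ⟨splice hstep (m + n) z z' e, rfl, hz.splice hstep hπ hz' e⟩, ?_, ?_, a, ha, ?_⟩
    · rw [head?_block _ _ hl, head?_block _ _ hl, splice_of_le hstep e (by omega), h1]
    · rw [getLast?_block _ _ hl, getLast?_block _ _ hl, splice_of_ge hstep e (by omega), h2']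
    · rw [getElem?_block _ _ hn, splice_of_le hstep e le_rfl, h2]

variable (π) in
/-- On `[m, n]` all paths over `y` are routable through some `k` symbols at an inner position. -/
def RoutableThrough (y : ℤ → B) (m n : ℤ) (k : ℕ∞) : Prop :=
  ∃ (c : ℤ) (M : Set A), m < c ∧ c < n ∧ M.encard ≤ k ∧ ∀ x : X.carrier, π.IsOver y m n x →
    ∃ a ∈ M, π.Conn y m c (x.1 m) a ∧ π.Conn y c n a (x.1 n)

lemma RoutableThrough.mono (hstep : IsStepSFT 1 X) (hπ : π.IsOneBlock) {y : ℤ → B}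
    {m n m' n' : ℤ} {k : ℕ∞} (h : π.RoutableThrough y m n k) (hm : m' ≤ m) (hn : n ≤ n') :
    π.RoutableThrough y m' n' k := by
  obtain ⟨c, M, hmc, hcn, hM, hr⟩ := h
  refine ⟨c, M, by omega, by omega, hM, fun x hx => ?_⟩
  obtain ⟨a, ha, h1, h2⟩ := hr x (hx.mono hm hn)
  exact ⟨a, ha, (hx.mono le_rfl (by omega)).conn.trans hstep hπ hm hmc.le h1,
    h2.trans hstep hπ hcn.le hn (hx.mono (by omega) le_rfl).conn⟩

/-- A finite bound forces the set under the infimum to be nonempty, so the infimum is attained;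
without an inner position both sides fail. -/
lemma depth_block_le_iff (hstep : IsStepSFT 1 X) (hπ : π.IsOneBlock) {y : ℤ → B} {m : ℤ} {l : ℕ}
    {k : ℕ} : π.depth (block y m l) ≤ k ↔ π.RoutableThrough y m (m + l - 1) k := by
  constructor
  · intro h
    have hne : {c : ℕ∞ | ∃ (n : ℕ) (M : Set A), 0 < n ∧ n + 1 < (block y m l).length ∧
        π.IsFiberRoutable (block y m l) M n ∧ c = M.encard}.Nonempty := by
      by_contra hcon
      rw [Set.not_nonempty_iff_eq_empty] at hcon
      rw [depth, hcon, sInf_empty, top_le_iff] at h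
      exact ENat.natCast_ne_top k h
    obtain ⟨n, M, hn, hnl, hr, hM⟩ := csInf_mem hne
    rw [block_length] at hnl
    refine ⟨m + n, M, by omega, by omega, hM ▸ h, fun x hx => ?_⟩
    exact (isRoutable_iff hstep hπ (by omega)).1 (hr _ (mem_wordFiber_block.2 ⟨x, rfl, hx⟩))
  · rintro ⟨c, M, hmc, hcn, hM, hr⟩
    refine le_trans (sInf_le ⟨(c - m).toNat, M, by omega, by rw [block_length]; omega, ?_, rfl⟩) hM
    intro u hu
    obtain ⟨x, rfl, hx⟩ := mem_wordFiber_block.1 hu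
    rw [isRoutable_iff hstep hπ (by omega), show m + ((c - m).toNat : ℤ) = c by omega]
    exact hr x hx

/-- Pigeonhole: `k + 1` paths lie in at most `k` tangled pieces. -/
lemma exists_twoWay_of_tDepth_le {y : ℤ → B} {m : ℤ} {l k : ℕ} (hl : 0 < l)
    (h : π.tDepth (block y m l) ≤ k) {p : Fin (k + 1) → X.carrier}
    (hp : ∀ i, π.IsOver y m (m + l - 1) (p i)) :
    ∃ i j, i ≠ j ∧ π.TwoWay y m (m + l - 1) (p i).1 (p j).1 := by
  have hne : {c : ℕ∞ | ∃ P : Set (Set (List A)), π.IsTangledPartition (block y m l) P ∧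
      c = P.encard}.Nonempty := by
    by_contra hcon
    rw [Set.not_nonempty_iff_eq_empty] at hcon
    rw [tDepth, hcon, sInf_empty, top_le_iff] at h
    exact ENat.natCast_ne_top k h
  obtain ⟨P, ⟨hU, -, -, ht⟩, hP⟩ := csInf_mem hne
  have hPk : P.encard ≤ k := hP ▸ h
  have hfin : P.Finite := Set.finite_of_encard_le_coe hPk
  have hmem : ∀ i, ∃ W ∈ P, block (p i).1 m l ∈ W := by
    intro i
    rw [← Set.mem_sUnion, hU, mem_wordFiber_block]
    exact ⟨p i, rfl, hp i⟩
  choose W hWP hW using hmem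
  have hcard : hfin.toFinset.card < (Finset.univ : Finset (Fin (k + 1))).card := by
    rw [hfin.encard_eq_coe_toFinset_card] at hPk
    simpa [Nat.lt_succ_iff] using hPk
  obtain ⟨i, -, j, -, hij, hWij⟩ := Finset.exists_ne_map_eq_of_card_lt_of_maps_to hcard
    (f := W) (fun i _ => by simpa using hWP i)
  have := (ht _ (hWP i)).2 _ (hW i) _ (hWij ▸ hW j)
  rw [exists_isBridge_iff hl, exists_isBridge_iff hl] at this
  exact ⟨i, j, hij, this⟩

/-- Sorting the words by the symbol they are routed through gives tangled pieces: the first half of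
one route continues with the second half of another. -/
lemma tDepth_le_depth (hstep : IsStepSFT 1 X) (hπ : π.IsOneBlock) (y : ℤ → B) (m : ℤ) (l : ℕ) :
    π.tDepth (block y m l) ≤ π.depth (block y m l) := by
  refine le_sInf ?_
  rintro c ⟨n, M, hn, hnl, hr, rfl⟩
  rw [block_length] at hnl
  set w := block y m l with hw
  have hr' : ∀ u ∈ π.wordFiber w, ∃ a ∈ M, π.IsRoutable w u {a} n := by
    intro u hu
    obtain ⟨v, hv, h1, h2, a, ha, h3⟩ := hr u hu
    exact ⟨a, ha, v, hv, h1, h2, a, rfl, h3⟩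
  choose g hgM hg using hr'
  let Q : A → Set (List A) := fun a => {u | ∃ hu : u ∈ π.wordFiber w, g u hu = a}
  -- Symbols of `M` assigned to no word give an empty piece, which a partition must not contain.
  refine le_trans (sInf_le ⟨Q '' M \ {∅}, ⟨?_, by simp, ?_, ?_⟩, rfl⟩)
    ((Set.encard_le_encard Set.sdiff_subset).trans (Set.encard_image_le Q M))
  · ext u
    constructor
    · rintro ⟨_, ⟨⟨a, -, rfl⟩, -⟩, hu⟩
      exact hu.fst
    · intro hu
      exact ⟨Q (g u hu), ⟨⟨g u hu, hgM u hu, rfl⟩, Set.nonempty_iff_ne_empty.1 ⟨u, hu, rfl⟩⟩, hu, rfl⟩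
  · rintro _ ⟨⟨a, -, rfl⟩, -⟩ _ ⟨⟨b, -, rfl⟩, -⟩ hab
    refine Set.disjoint_left.2 fun u hua hub => hab ?_
    obtain ⟨hu, rfl⟩ := hua
    rw [hub.2]
  · rintro _ ⟨⟨a, -, rfl⟩, -⟩
    refine ⟨fun u hu => hu.fst, ?_⟩
    have key : ∀ u ∈ Q a, ∀ u' ∈ Q a, ∃ v, π.IsBridge w u u' v := by
      rintro u ⟨hu, hua⟩ u' ⟨hu', hua'⟩
      have h1 := hg u hu
      have h2 := hg u' hu'
      obtain ⟨x, rfl, hx⟩ := mem_wordFiber_block.1 hu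
      obtain ⟨x', rfl, hx'⟩ := mem_wordFiber_block.1 hu'
      rw [isRoutable_iff hstep hπ (by omega)] at h1 h2
      obtain ⟨b, hb, h1, -⟩ := h1
      obtain ⟨b', hb', -, h2⟩ := h2
      rw [Set.mem_singleton_iff.1 hb, hua] at h1
      rw [Set.mem_singleton_iff.1 hb', hua'] at h2
      exact (exists_isBridge_iff (by omega)).2 (h1.trans hstep hπ (by omega) (by omega) h2)
    exact fun u hu u' hu' => ⟨key u hu u' hu', key u' hu' u hu⟩

end FactorCode

end ClassDegree

/-! ### Compactness, and the class degree as minimal depth and t-depth. -/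

namespace ClassDegree

section Compactness

variable {A : Type*} [TopologicalSpace A] {X : Subshift A ℤ}

/-- The set is the preimage of a set of patterns on `[m, n]`, a discrete space. -/
lemma isClosed_of_local [DiscreteTopology A] {S : Set X.carrier} (m n : ℤ)
    (h : ∀ x x' : X.carrier, (∀ i, m ≤ i → i ≤ n → x.1 i = x'.1 i) → x ∈ S → x' ∈ S) :
    IsClosed S := by
  let r : X.carrier → (Set.Icc m n → A) := fun x i => x.1 i
  have hr : Continuous r :=
    continuous_pi fun i => (continuous_apply (i : ℤ)).comp continuous_subtype_val
  have hS : S = r ⁻¹' (r '' S) := by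
    refine (Set.subset_preimage_image r S).antisymm ?_
    rintro x' ⟨x, hx, hxx'⟩
    exact h x x' (fun i hi hi' => congrFun hxx' ⟨i, hi, hi'⟩) hx
  rw [hS]
  exact (isClosed_discrete _).preimage hr

lemma exists_forall_mem_of_decreasing [Finite A] (C : ℕ → Set X.carrier) (hC : ∀ K, C (K + 1) ⊆ C K)
    (hne : ∀ K, (C K).Nonempty) (hcl : ∀ K, IsClosed (C K)) :
    ∃ x, ∀ K, x ∈ C K := by
  have : CompactSpace X.carrier := isCompact_iff_compactSpace.1 X.isClosed.isCompact
  obtain ⟨x, hx⟩ := IsCompact.nonempty_iInter_of_sequence_nonempty_isCompact_isClosed C hC hne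
    (hcl 0).isCompact hcl
  exact ⟨x, Set.mem_iInter.1 hx⟩

end Compactness

namespace FactorCode

variable {A B : Type*} [TopologicalSpace A] [TopologicalSpace B]
  {X : Subshift A ℤ} {Y : Subshift B ℤ} {π : FactorCode X Y}

lemma IsOver.of_agree (hπ : π.IsOneBlock) {y : ℤ → B} {m n : ℤ} {x x' : X.carrier}
    (h : π.IsOver y m n x) (hx : ∀ i, m ≤ i → i ≤ n → x.1 i = x'.1 i) : π.IsOver y m n x' :=
  fun k hk hk' => by rw [← hπ.map_eq (hx k hk hk'), h k hk hk']

lemma RoutableThrough.congr {y y' : ℤ → B} {m n : ℤ} {k : ℕ∞} (h : π.RoutableThrough y m n k)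
    (hy : ∀ i, m ≤ i → i ≤ n → y i = y' i) : π.RoutableThrough y' m n k := by
  obtain ⟨c, M, hmc, hcn, hM, hr⟩ := h
  refine ⟨c, M, hmc, hcn, hM, fun x hx => ?_⟩
  obtain ⟨a, ha, h1, h2⟩ := hr x fun i hi hi' => (hx i hi hi').trans (hy i hi hi').symm
  exact ⟨a, ha, h1.congr fun i hi hi' => (hy i hi (by omega)).symm,
    h2.congr fun i hi hi' => (hy i (by omega) hi').symm⟩

variable (π) in
lemma exists_eq_block {w : List B} (hw : w ∈ language Y) (m : ℤ) :
    ∃ x : X.carrier, w = block (π.toFun x).1 m w.length := by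
  obtain ⟨y, i, h⟩ := language_iff.1 hw
  obtain ⟨x, hx⟩ := π.surjective_toFun y
  refine ⟨translate (i - m) x, h.trans ?_⟩
  rw [block_eq_block_iff]
  intro k hk
  rw [map_translate_apply, hx]
  exact congrArg y.1 (by ring)

/-- For `k + 1` inequivalent points, `exists_threshold` would forbid the two-way connections
supplied far to the right. -/
lemma rightClassCount_le (hstep : IsStepSFT 1 X) (hπ : π.IsOneBlock) {y : Y.carrier} {k : ℕ}
    (h : ∀ R : ℤ, ∃ m ≥ R, ∃ n ≥ m, ∀ p : Fin (k + 1) → X.carrier,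
      (∀ i, π.IsOver y.1 m n (p i)) → ∃ i j, i ≠ j ∧ π.TwoWay y.1 m n (p i).1 (p j).1) :
    π.rightClassCount y ≤ k := by
  by_contra! hcon
  obtain ⟨p, hp, hpe⟩ := exists_inequivalent_of_le hstep hπ (k := k + 1)
    (by push_cast; exact Order.add_one_le_of_lt hcon)
  obtain ⟨R, hR⟩ := exists_threshold hstep hπ hp hpe
  obtain ⟨m, hm, n, hn, hmn⟩ := h R
  obtain ⟨i, j, hij, htw⟩ := hmn p fun i => isOver_of_eq (hp i) m n
  exact hij (hR m hm n hn i j htw)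

lemma classDegree_le_tDepth (hirr : IsIrreducible X) (hstep : IsStepSFT 1 X) (hπ : π.IsOneBlock)
    {w : List B} (hw : w ∈ language Y) (hw0 : w ≠ []) : π.classDegree ≤ π.tDepth w := by
  obtain ⟨k, hk⟩ | hk : (∃ k : ℕ, π.tDepth w = k) ∨ π.tDepth w = ⊤ := by
    induction π.tDepth w with
    | top => exact .inr rfl
    | coe k => exact .inl ⟨k, rfl⟩
  swap
  · rw [hk]
    exact le_top
  have hl : 0 < w.length := List.length_pos_iff.2 hw0
  obtain ⟨x, hx⟩ := π.exists_eq_block hw 0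
  obtain ⟨q, L, hL, hq, hqx⟩ := exists_periodic hirr hstep x (a := 0) (b := w.length) (by omega)
  rw [hk]
  refine (iInf_le _ (π.toFun q)).trans (rightClassCount_le hstep hπ fun R => ?_)
  -- As `L ≥ 1`, copy number `R.toNat` of `w` starts at or beyond `R`.
  have hR : R ≤ 0 + R.toNat * L := by
    nlinarith [Int.self_le_toNat R, Int.natCast_nonneg R.toNat]
  refine ⟨0 + R.toNat * L, hR, 0 + R.toNat * L + w.length - 1, by omega, fun p hp => ?_⟩
  refine exists_twoWay_of_tDepth_le hl ?_ hp
  rw [← hk]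
  refine le_of_eq (congrArg π.tDepth ?_)
  conv_rhs => rw [hx]
  rw [block_eq_block_iff]
  intro j hj
  apply hπ.map_eq
  rw [show 0 + (R.toNat : ℤ) * L + j = (0 + j) + R.toNat * L by ring,
    apply_add_mul_of_periodic hq, hqx _ (by omega) (by omega)]

/-- Every point of `Y` has a central word whose paths are routable through as many symbols as
there are classes over the point. -/
lemma exists_routableThrough [Finite A] [DiscreteTopology A] (hstep : IsStepSFT 1 X)
    (hπ : π.IsOneBlock) (y : Y.carrier) :
    ∃ K : ℕ, π.RoutableThrough y.1 (-K) K (π.rightClassCount y) := by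
  obtain ⟨k, hk⟩ | hk : (∃ k : ℕ, π.rightClassCount y = k) ∨ π.rightClassCount y = ⊤ := by
    induction π.rightClassCount y with
    | top => exact .inr rfl
    | coe k => exact .inl ⟨k, rfl⟩
  swap
  · refine ⟨1, 0, Set.univ, by simp, by simp, by rw [hk]; exact le_top, fun x hx =>
      ⟨x.1 0, Set.mem_univ _, ?_, ?_⟩⟩
    · exact (hx.mono le_rfl (by simp)).conn
    · exact (hx.mono (by simp) le_rfl).conn
  obtain ⟨p, hp, -, hrep⟩ := exists_representatives hstep hπ hk
  have hov : ∀ i m n, π.IsOver y.1 m n (p i) := fun i => isOver_of_eq (hp i)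
  have hN : ∀ (a : A) (i : Fin k), ∃ N : ℤ, 0 < N ∧ ((∃ n > 0, π.Conn y.1 0 n a ((p i).1 n)) →
      ∀ n ≥ N, π.Conn y.1 0 n a ((p i).1 n)) := by
    intro a i
    by_cases h : ∃ n > 0, π.Conn y.1 0 n a ((p i).1 n)
    · obtain ⟨n, hn, h⟩ := h
      exact ⟨n, hn, fun _ n' hn' => h.trans hstep hπ hn.le hn' (hov i _ _).conn⟩
    · exact ⟨1, one_pos, fun h' => absurd h' h⟩
  choose N hN0 hN using hN
  obtain ⟨N', hN'⟩ := (Set.finite_range fun ai : A × Fin k => N ai.1 ai.2).bddAbove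
  obtain ⟨c, hc0, hcN⟩ : ∃ c : ℤ, 0 < c ∧ N' ≤ c := ⟨max N' 1, by simp, by simp⟩
  -- `C K` collects the paths over `y` on `[-K, K]` that no `p i` at `c` can route. A point common
  -- to all `C K` lies over `y`, is equivalent to some `p i`, and is therefore routable after all.
  let C : ℕ → Set X.carrier := fun K => {x | π.IsOver y.1 (-K) K x ∧
    ¬ ∃ i, ∃ n, c < n ∧ n ≤ K ∧ π.Conn y.1 0 c (x.1 0) ((p i).1 c) ∧
      π.Conn y.1 c n ((p i).1 c) (x.1 n)}
  have hC : ∃ K, C K = ∅ := by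
    by_contra! hcon
    obtain ⟨x, hx⟩ := exists_forall_mem_of_decreasing C (fun K x hx => ⟨hx.1.mono (by simp)
        (by simp), fun ⟨i, n, hcn, hn, h⟩ => hx.2 ⟨i, n, hcn, by push_cast; omega, h⟩⟩) hcon
      (fun K => isClosed_of_local (-K) K fun x x' hxx' hx => ⟨hx.1.of_agree hπ hxx', by
        rintro ⟨i, n, hcn, hn, h1, h2⟩
        refine hx.2 ⟨i, n, hcn, hn, ?_, ?_⟩
        · rwa [hxx' 0 (by simp) (by simp)]
        · rwa [hxx' n (by omega) hn]⟩)
    have hxy : π.toFun x = y := by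
      ext i
      exact (hx i.natAbs).1 i (by omega) (by omega)
    obtain ⟨i, hi1, hi2⟩ := hrep x hxy
    rw [rightTransition_iff hstep hπ, hxy] at hi1
    rw [rightTransition_iff hstep hπ, hp] at hi2
    have h1 := hN (x.1 0) i (hi1.2 0) c ((hN' ⟨(x.1 0, i), rfl⟩).trans hcN)
    obtain ⟨n, hn, h2⟩ := hi2.2 c
    exact (hx n.toNat).2 ⟨i, n, hn, by omega, h1, h2⟩
  obtain ⟨K, hK⟩ := hC
  obtain ⟨x₀, hx₀⟩ := π.surjective_toFun y
  have hex : ∀ x : X.carrier, π.IsOver y.1 (-K) K x → ∃ i, ∃ n, c < n ∧ n ≤ K ∧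
      π.Conn y.1 0 c (x.1 0) ((p i).1 c) ∧ π.Conn y.1 c n ((p i).1 c) (x.1 n) := by
    intro x hx
    by_contra hcon
    have : x ∈ C K := ⟨hx, hcon⟩
    rw [hK] at this
    exact this
  have hcK : c < K := by
    obtain ⟨-, n, hcn, hn, -⟩ := hex x₀ (isOver_of_eq hx₀ _ _)
    omega
  refine ⟨K, c, Set.range fun i => (p i).1 c, by omega, hcK, ?_, fun x hx => ?_⟩
  · rw [hk, ← Set.image_univ]
    refine (Set.encard_image_le _ _).trans ?_
    simp
  · obtain ⟨i, n, hcn, hn, h1, h2⟩ := hex x hx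
    exact ⟨_, ⟨i, rfl⟩, (hx.mono le_rfl (by omega)).conn.trans hstep hπ (by omega) hc0.le h1,
      h2.trans hstep hπ hcn.le hn (hx.mono (by omega) le_rfl).conn⟩

/-- The points failing for `K` form decreasing closed sets in the compact `Y`; a common point
contradicts `exists_routableThrough`. -/
lemma exists_routableThrough_of_count_le [Finite A] [DiscreteTopology A] [Finite B]
    [DiscreteTopology B] (hstep : IsStepSFT 1 X) (hπ : π.IsOneBlock) {k : ℕ∞}
    (h : ∀ y, π.rightClassCount y ≤ k) :
    ∃ K : ℕ, ∀ y : Y.carrier, π.RoutableThrough y.1 (-K) K k := by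
  by_contra! hcon
  obtain ⟨y, hy⟩ := exists_forall_mem_of_decreasing
    (fun K : ℕ => {y : Y.carrier | ¬ π.RoutableThrough y.1 (-K) K k})
    (fun K y hy hr => hy (hr.mono hstep hπ (by simp) (by simp))) hcon
    (fun K => isClosed_of_local (-K) K fun y y' hyy' hy hr =>
      hy (hr.congr fun i hi hi' => (hyy' i hi hi').symm))
  obtain ⟨K, c, M, h1, h2, hM, hr⟩ := exists_routableThrough hstep hπ y
  exact hy K ⟨c, M, h1, h2, hM.trans (h y), hr⟩

lemma exists_depth_le_classDegree [Finite A] [DiscreteTopology A] [Nonempty Y.carrier]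
    (hstep : IsStepSFT 1 X) (hπ : π.IsOneBlock) {k : ℕ} (hk : π.classDegree ≤ k) :
    ∃ w ∈ language Y, w ≠ [] ∧ π.depth w ≤ k := by
  obtain ⟨y, hy⟩ := ciInf_mem π.rightClassCount
  obtain ⟨K, c, M, h1, h2, hM, hr⟩ := exists_routableThrough hstep hπ y
  have hb : (-K + ((2 * K + 1 : ℕ) : ℤ) - 1) = K := by push_cast; ring
  refine ⟨block y.1 (-K) (2 * K + 1), block_mem_language y _ _, ?_, ?_⟩
  · rw [← List.length_pos_iff, block_length]
    omega
  · rw [depth_block_le_iff hstep hπ, hb]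
    exact ⟨c, M, h1, h2, hM.trans (hy.trans_le hk), hr⟩

lemma tDepth_le_depth_of_mem_language (hstep : IsStepSFT 1 X) (hπ : π.IsOneBlock) {w : List B}
    (hw : w ∈ language Y) : π.tDepth w ≤ π.depth w := by
  obtain ⟨x, hx⟩ := π.exists_eq_block hw 0
  rw [hx]
  exact tDepth_le_depth hstep hπ _ _ _

/-- The class degree is a lower bound for the depths of nonempty words, and when finite it is
attained by a central word of a point with the fewest classes. -/
lemma isMinimalDepth_iff [Finite A] [DiscreteTopology A] (hirr : IsIrreducible X)
    (hstep : IsStepSFT 1 X) (hπ : π.IsOneBlock) {d : ℕ} :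
    π.IsMinimalDepth d ↔ π.classDegree = d := by
  constructor
  · rintro ⟨⟨w, hw, hw0, hd⟩, hmin⟩
    have hY : Nonempty Y.carrier := ⟨(language_iff.1 hw).choose⟩
    have hle : π.classDegree ≤ d := (classDegree_le_tDepth hirr hstep hπ hw hw0).trans
      ((tDepth_le_depth_of_mem_language hstep hπ hw).trans hd.ge)
    refine hle.antisymm ?_
    obtain ⟨k, hk, -⟩ := ENat.le_natCast_iff.1 hle
    obtain ⟨v, hv, hv0, hvd⟩ := exists_depth_le_classDegree hstep hπ hk.le
    rw [hk]
    exact (hmin ⟨v, hv, hv0, rfl⟩).trans hvd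
  · intro h
    have hY : Nonempty Y.carrier := by
      by_contra hcon
      rw [not_nonempty_iff] at hcon
      rw [classDegree, iInf_of_empty] at h
      exact ENat.top_ne_natCast d h
    have hlow : ∀ w ∈ language Y, w ≠ [] → (d : ℕ∞) ≤ π.depth w := fun w hw hw0 =>
      h.ge.trans ((classDegree_le_tDepth hirr hstep hπ hw hw0).trans
        (tDepth_le_depth_of_mem_language hstep hπ hw))
    obtain ⟨v, hv, hv0, hvd⟩ := exists_depth_le_classDegree hstep hπ h.le
    refine ⟨⟨v, hv, hv0, (hlow v hv hv0).antisymm hvd⟩, ?_⟩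
    rintro _ ⟨w, hw, hw0, rfl⟩
    exact hlow w hw hw0

lemma isMinimalTDepth_iff [Finite A] [DiscreteTopology A] (hirr : IsIrreducible X)
    (hstep : IsStepSFT 1 X) (hπ : π.IsOneBlock) {d : ℕ} :
    π.IsMinimalTDepth d ↔ π.classDegree = d := by
  constructor
  · rintro ⟨⟨w, hw, hw0, hd⟩, hmin⟩
    have hY : Nonempty Y.carrier := ⟨(language_iff.1 hw).choose⟩
    have hle : π.classDegree ≤ d := (classDegree_le_tDepth hirr hstep hπ hw hw0).trans hd.ge
    refine hle.antisymm ?_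
    obtain ⟨k, hk, -⟩ := ENat.le_natCast_iff.1 hle
    obtain ⟨v, hv, hv0, hvd⟩ := exists_depth_le_classDegree hstep hπ hk.le
    rw [hk]
    exact (hmin ⟨v, hv, hv0, rfl⟩).trans ((tDepth_le_depth_of_mem_language hstep hπ hv).trans hvd)
  · intro h
    obtain ⟨⟨v, hv, hv0, hvd⟩, -⟩ := (isMinimalDepth_iff hirr hstep hπ).2 h
    have hlow : ∀ w ∈ language Y, w ≠ [] → (d : ℕ∞) ≤ π.tDepth w := fun w hw hw0 =>
      h.ge.trans (classDegree_le_tDepth hirr hstep hπ hw hw0)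
    refine ⟨⟨v, hv, hv0, (hlow v hv hv0).antisymm ?_⟩, ?_⟩
    · exact (tDepth_le_depth_of_mem_language hstep hπ hv).trans hvd.ge
    · rintro _ ⟨w, hw, hw0, rfl⟩
      exact hlow w hw hw0

/-- The three characterizations of constant-class-to-one codes are equivalent. -/
lemma tfae_constant [Finite A] [DiscreteTopology A] [Finite B] [DiscreteTopology B]
    (hirr : IsIrreducible X) (hstep : IsStepSFT 1 X) (hπ : π.IsOneBlock) (d : ℕ) :
    List.TFAE
      [π.IsConstantClassToOne ∧ π.classDegree = d,
       π.IsMinimalDepth d ∧ ∃ N > 0, ∀ w ∈ language Y, w.length = N → π.depth w = d,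
       π.IsMinimalTDepth d ∧ ∃ N > 0, ∀ w ∈ language Y, w.length = N → π.tDepth w = d] := by
  tfae_have 1 → 2 := by
    rintro ⟨hc, hd⟩
    have hmin := (isMinimalDepth_iff hirr hstep hπ).2 hd
    refine ⟨hmin, ?_⟩
    obtain ⟨K, hK⟩ := exists_routableThrough_of_count_le hstep hπ fun y => ((hc y).trans hd).le
    refine ⟨2 * K + 1, by omega, fun w hw hwl => ?_⟩
    have hw0 : w ≠ [] := by
      rw [← List.length_pos_iff]
      omega
    refine le_antisymm ?_ (hmin.2 ⟨w, hw, hw0, rfl⟩)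
    obtain ⟨x, hx⟩ := π.exists_eq_block hw (-K)
    have hb : (-K + ((2 * K + 1 : ℕ) : ℤ) - 1) = K := by push_cast; ring
    rw [hx, hwl, depth_block_le_iff hstep hπ, hb]
    exact hK _
  tfae_have 2 → 3 := by
    rintro ⟨hmin, N, hN, hw⟩
    have hmin' := (isMinimalTDepth_iff hirr hstep hπ).2 ((isMinimalDepth_iff hirr hstep hπ).1 hmin)
    -- The same `N` serves: the t-depth lies between its minimum `d` and the depth `d`.
    refine ⟨hmin', N, hN, fun w hwY hwl => le_antisymm ?_ ?_⟩
    · exact (tDepth_le_depth_of_mem_language hstep hπ hwY).trans (hw w hwY hwl).le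
    · refine hmin'.2 ⟨w, hwY, ?_, rfl⟩
      rw [← List.length_pos_iff]
      omega
  tfae_have 3 → 1 := by
    rintro ⟨hmin, N, hN, hw⟩
    have hd := (isMinimalTDepth_iff hirr hstep hπ).1 hmin
    refine ⟨fun y => le_antisymm ?_ (iInf_le _ y), hd⟩
    rw [hd]
    refine rightClassCount_le hstep hπ fun R => ⟨R, le_rfl, R + N - 1, by omega, fun p hp => ?_⟩
    exact exists_twoWay_of_tDepth_le hN (hw _ (block_mem_language y R N) (by simp)).le hp
  tfae_finish

end FactorCode

end ClassDegree

/-! ### Constant class count implies bi-continuing and bi-class-closing. -/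

namespace ClassDegree

namespace FactorCode

variable {A B : Type*} [TopologicalSpace A] [TopologicalSpace B]
  {X : Subshift A ℤ} {Y : Subshift B ℤ} {π : FactorCode X Y}

variable (π) in
/-- Among any `d + 1` points over `y ∈ Y` on an interval of length `N`, two are connected in both
directions. -/
def IsTangledAt (d N : ℕ) : Prop :=
  ∀ (y : Y.carrier) (m : ℤ) (p : Fin (d + 1) → X.carrier),
    (∀ i, π.IsOver y.1 m (m + N - 1) (p i)) →
      ∃ i j, i ≠ j ∧ π.TwoWay y.1 m (m + N - 1) (p i).1 (p j).1

/-- Adjoining `x` to `d` separated points produces a two-way pair, and that pair must involve `x`.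
-/
lemma IsTangledAt.exists_twoWay {d N : ℕ} (h : π.IsTangledAt d N) {y : Y.carrier} {m : ℤ}
    {p : Fin d → X.carrier} (hp : ∀ i, π.IsOver y.1 m (m + N - 1) (p i))
    (hne : ∀ i j, π.TwoWay y.1 m (m + N - 1) (p i).1 (p j).1 → i = j) {x : X.carrier}
    (hx : π.IsOver y.1 m (m + N - 1) x) : ∃ i, π.TwoWay y.1 m (m + N - 1) x.1 (p i).1 := by
  obtain ⟨i, j, hij, htw⟩ := h y m (Fin.cons x p) (Fin.cases hx hp)
  induction i using Fin.cases with
  | zero =>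
    induction j using Fin.cases with
    | zero => exact absurd rfl hij
    | succ j => exact ⟨j, htw⟩
  | succ i =>
    induction j using Fin.cases with
    | zero => exact ⟨i, htw.symm⟩
    | succ j => exact absurd (congrArg Fin.succ (hne i j htw)) hij

/-- Two systems of `d` separated points over a long interval match. -/
lemma IsTangledAt.exists_matching (hstep : IsStepSFT 1 X) (hπ : π.IsOneBlock) {d N : ℕ}
    (hN : 0 < N) (h : π.IsTangledAt d N) {y : Y.carrier} {a b : ℤ}
    (hab : a + (Fintype.card (Fin d → Fin d) + 1 : ℕ) * N - 1 = b) {p z : Fin d → X.carrier}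
    (hp : ∀ i, π.IsOver y.1 a b (p i)) (hz : ∀ i, π.IsOver y.1 a b (z i))
    (hpne : ∀ i j, π.TwoWay y.1 a b (p i).1 (p j).1 → i = j)
    (hzne : ∀ i j, π.TwoWay y.1 a b (z i).1 (z j).1 → i = j) :
    ∃ φ : Equiv.Perm (Fin d), ∀ i, π.TwoWay y.1 a b (z i).1 (p (φ i)).1 := by
  -- There are `D + 1` windows of length `N` and only `D` maps from indices of `z` to indices of
  -- `p`, so two windows induce the same map.
  set D := Fintype.card (Fin d → Fin d) with hD
  have hstart : ∀ s : Fin (D + 1), a ≤ a + s * N := fun s => by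
    have : 0 ≤ (s : ℤ) * N := by positivity
    omega
  have hend : ∀ s : Fin (D + 1), a + s * N + N - 1 ≤ b := fun s => by
    have h1 : ((s : ℕ) + 1) * N ≤ (D + 1) * N := Nat.mul_le_mul_right N s.2
    have h2 : ((s : ℤ) + 1) * N ≤ ((D + 1 : ℕ) : ℤ) * N := by exact_mod_cast h1
    linarith
  have hex : ∀ (s : Fin (D + 1)) (i : Fin d), ∃ j,
      π.TwoWay y.1 (a + s * N) (a + s * N + N - 1) (z i).1 (p j).1 := fun s i =>
    h.exists_twoWay (fun j => (hp j).mono (hstart s) (hend s))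
      (fun j j' hjj' => hpne j j' (hjj'.extend hstep hπ (hstart s) (by omega) (hend s) (hp j)
        (hp j'))) ((hz i).mono (hstart s) (hend s))
  choose φ hφ using hex
  obtain ⟨s, s', hss, hφs⟩ : ∃ s s', s < s' ∧ φ s = φ s' := by
    obtain ⟨s, s', hne, he⟩ := Fintype.exists_ne_map_eq_of_card_lt φ (by simp [hD])
    rcases lt_or_gt_of_ne hne with hlt | hlt
    · exact ⟨s, s', hlt, he⟩
    · exact ⟨s', s, hlt, he.symm⟩
  have hgap : a + (s : ℤ) * N + N - 1 ≤ a + s' * N := by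
    have h1 : ((s : ℕ) + 1) * N ≤ s' * N := Nat.mul_le_mul_right N hss
    have h2 : ((s : ℤ) + 1) * N ≤ (s' : ℤ) * N := by exact_mod_cast h1
    linarith
  -- `z i` joins `p (φ s i)` in window `s`, follows it, and leaves for `z j` in window `s'`.
  -- Separation of the `z i` then makes `φ s` injective.
  have hconn : ∀ i j, φ s i = φ s j → π.Conn y.1 a b ((z i).1 a) ((z j).1 b) := by
    intro i j hij
    have h1 := (hφ s i).1
    have h2 := (hφ s' j).2
    rw [← hφs, ← hij] at h2
    have hm : π.Conn y.1 (a + s * N + N - 1) (a + s' * N) ((p (φ s i)).1 _) ((p (φ s i)).1 _) :=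
      ((hp (φ s i)).mono (by have := hstart s; omega) (by have := hend s'; omega)).conn
    exact ((h1.trans hstep hπ (by omega) hgap hm).trans hstep hπ (by omega) (by omega) h2).extend
      hstep hπ (hstart s) (by omega) (hend s') ((hz i).mono le_rfl (by have := hend s; omega))
      ((hz j).mono (by have := hstart s'; omega) le_rfl)
  have hinj : Function.Injective (φ s) := fun i j hij =>
    hzne i j ⟨hconn i j hij, hconn j i hij.symm⟩
  exact ⟨Equiv.ofBijective (φ s) (Finite.injective_iff_bijective.1 hinj), fun i =>
    (hφ s i).extend hstep hπ (hstart s) (by omega) (hend s) (hz i) (hp _)⟩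

/-- The image of a periodic point repeats the block of `y` on `[a, b]`; `d` inequivalent points over
that image are separated far to the right, and translation brings them back. -/
lemma exists_separated (hirr : IsIrreducible X) (hstep : IsStepSFT 1 X) (hπ : π.IsOneBlock)
    {d : ℕ} (hd : ∀ y, π.rightClassCount y = d) (y : Y.carrier) {a b : ℤ} (hab : a ≤ b) :
    ∃ p : Fin d → X.carrier, (∀ i, π.IsOver y.1 a b (p i)) ∧
      ∀ i j, π.TwoWay y.1 a b (p i).1 (p j).1 → i = j := by
  obtain ⟨x, rfl⟩ := π.surjective_toFun y
  obtain ⟨q, L, hL, hq, hqx⟩ := exists_periodic hirr hstep x hab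
  obtain ⟨p, hp, hpe⟩ := exists_inequivalent_of_le hstep hπ (hd (π.toFun q)).ge
  obtain ⟨R, hR⟩ := exists_threshold hstep hπ hp hpe
  obtain ⟨t, ht, hqt⟩ : ∃ t, R ≤ a + t ∧ ∀ k, q.1 (k + t) = q.1 k :=
    ⟨(R - a).toNat * L, by nlinarith [Int.self_le_toNat (R - a), Int.natCast_nonneg (R - a).toNat],
      fun k => apply_add_mul_of_periodic hq k _⟩
  have hy : ∀ k, a ≤ k → k ≤ b → (π.toFun q).1 (k + t) = (π.toFun x).1 k := fun k hk hk' =>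
    hπ.map_eq (by rw [hqt, hqx k hk hk'])
  refine ⟨fun i => translate t (p i), fun i k hk hk' => ?_, fun i j hij => ?_⟩
  · rw [map_translate_apply, hp, add_comm, hy k hk hk']
  · refine hR (a + t) ht (b + t) (by omega) i j ⟨?_, ?_⟩
    · simpa [add_comm] using hij.1.translate t hy
    · simpa [add_comm] using hij.2.translate t hy

/-- On the last `N` coordinates of the agreement, `x` is connected to one of `d` paths separated
over `[m, n + K]`, so it can be continued to `n + K`. Compactness in `K` gives an infinite
continuation. -/
lemma isRightContinuing_of_isTangledAt [Finite A] [DiscreteTopology A] (hirr : IsIrreducible X)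
    (hstep : IsStepSFT 1 X) (hπ : π.IsOneBlock) {d N : ℕ} (hN : 0 < N)
    (hd : ∀ y, π.rightClassCount y = d) (hT : π.IsTangledAt d N) : π.IsRightContinuing := by
  rintro x y ⟨n, hn⟩
  set m : ℤ := n - N + 1 with hm
  have hmn : m + N - 1 = n := by omega
  have hx : π.IsOver y.1 m n x := fun k _ hk => (hn k hk).symm
  obtain ⟨z, hz⟩ := exists_forall_mem_of_decreasing
    (fun K : ℕ => {z : X.carrier | z.1 m = x.1 m ∧ π.IsOver y.1 m (n + K) z})
    (fun K z hz => ⟨hz.1, hz.2.mono le_rfl (by push_cast; omega)⟩)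
    (fun K => by
      obtain ⟨p, hp, hpe⟩ := exists_separated hirr hstep hπ hd y (a := m) (b := n + K) (by omega)
      -- Separation over a long interval passes to subintervals, because two-way connections extend
      -- to longer intervals.
      obtain ⟨i, hi⟩ := hT.exists_twoWay (x := x) (fun i => (hp i).mono le_rfl (by omega))
        (fun i j hij => hpe i j (hij.extend hstep hπ le_rfl (by omega) (by omega) (hp i) (hp j)))
        (by rwa [hmn])
      rw [hmn] at hi
      obtain ⟨z, hz, -, hzy⟩ := hi.1.extend hstep hπ le_rfl (by omega) (n' := n + K) (by omega)
        (hx.mono le_rfl (by omega)) ((hp i).mono (by omega) le_rfl)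
      exact ⟨z, hz, hzy⟩)
    (fun K => isClosed_of_local m (n + K) fun z z' hzz' hz => ⟨by
      rw [← hzz' m le_rfl (by omega), hz.1], hz.2.of_agree hπ hzz'⟩)
  have e : x.1 m = z.1 m := (hz 0).1.symm
  refine ⟨splice hstep m x z e, ?_, m, fun i hi => splice_of_le hstep e hi⟩
  ext i
  rcases le_total i m with him | him
  · rw [hπ.map_eq (splice_of_le hstep e him), hn i (by omega)]
  · rw [hπ.map_eq (splice_of_ge hstep e him), (hz (i - n).toNat).2 i him (by omega)]

/-- Two-way connections favour no direction of time: the other half of the pair leads from a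
separated path back into `x`. -/
lemma isLeftContinuing_of_isTangledAt [Finite A] [DiscreteTopology A] (hirr : IsIrreducible X)
    (hstep : IsStepSFT 1 X) (hπ : π.IsOneBlock) {d N : ℕ} (hN : 0 < N)
    (hd : ∀ y, π.rightClassCount y = d) (hT : π.IsTangledAt d N) : π.IsLeftContinuing := by
  rintro x y ⟨m, hm⟩
  set n : ℤ := m + N - 1 with hn
  have hx : π.IsOver y.1 m n x := fun k hk _ => (hm k hk).symm
  obtain ⟨z, hz⟩ := exists_forall_mem_of_decreasing
    (fun K : ℕ => {z : X.carrier | z.1 n = x.1 n ∧ π.IsOver y.1 (m - K) n z})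
    (fun K z hz => ⟨hz.1, hz.2.mono (by push_cast; omega) le_rfl⟩)
    (fun K => by
      obtain ⟨p, hp, hpe⟩ := exists_separated hirr hstep hπ hd y (a := m - K) (b := n) (by omega)
      obtain ⟨i, hi⟩ := hT.exists_twoWay (fun i => (hp i).mono (by omega) hn.ge)
        (fun i j hij => hpe i j (hij.extend hstep hπ (by omega) (by omega) hn.ge (hp i) (hp j))) hx
      obtain ⟨z, -, hz, hzy⟩ := hi.2.extend hstep hπ (m' := m - K) (by omega) (by omega) hn.ge
        ((hp i).mono le_rfl (by omega)) (hx.mono (by omega) le_rfl)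
      exact ⟨z, hz, hzy⟩)
    (fun K => isClosed_of_local (m - K) n fun z z' hzz' hz => ⟨by
      rw [← hzz' n (by omega) le_rfl, hz.1], hz.2.of_agree hπ hzz'⟩)
  have e : z.1 n = x.1 n := (hz 0).1
  refine ⟨splice hstep n z x e, ?_, n, fun i hi => splice_of_ge hstep e hi⟩
  ext i
  rcases le_total i n with hin | hin
  · rw [hπ.map_eq (splice_of_le hstep e hin), (hz (m - i).toNat).2 i (by omega) hin]
  · rw [hπ.map_eq (splice_of_ge hstep e hin), hm i (by omega)]

/-- A permutation that only moves along right transitions fixes pairwise inequivalent points. -/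
lemma perm_eq_one_of_rightTransition (hstep : IsStepSFT 1 X) (hπ : π.IsOneBlock) {ι : Type*}
    [Finite ι] {p : ι → X.carrier} (hpe : ∀ i j, π.RightEquiv (p i) (p j) → i = j)
    {τ : Equiv.Perm ι} (h : ∀ i, π.RightTransition (p i) (p (τ i))) : τ = 1 := by
  have hpow : ∀ (k : ℕ) (i : ι), π.RightTransition (p i) (p ((τ ^ k) i)) := by
    intro k
    induction k with
    | zero => exact fun i => π.rightTransition_refl _
    | succ k ih =>
      intro i
      rw [pow_succ, Equiv.Perm.mul_apply]
      exact (h i).trans hstep hπ (ih (τ i))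
  ext i
  refine (hpe _ _ ⟨h i, ?_⟩).symm
  -- The remaining steps of the cycle lead from `τ i` back to `i`.
  have := hpow (orderOf τ - 1) (τ i)
  rwa [← Equiv.Perm.mul_apply, ← pow_succ, Nat.sub_add_cancel (orderOf_pos τ), pow_orderOf_eq_one,
    Equiv.Perm.one_apply] at this

/-- Points over the same point that agree on one side are connected both ways on both sides. -/
lemma exists_twoWay_of_asymptotic (hirr : IsIrreducible X)
    (hstep : IsStepSFT 1 X) (hπ : π.IsOneBlock) {d N : ℕ} (hN : 0 < N)
    (hd : ∀ y, π.rightClassCount y = d) (hT : π.IsTangledAt d N) {x x' : X.carrier}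
    (he : π.toFun x = π.toFun x') {n₀ n₁ : ℤ} (hn : n₀ ≤ n₁)
    (hx : (∀ i ≤ n₀, x.1 i = x'.1 i) ∨ ∀ i ≥ n₁, x.1 i = x'.1 i) :
    (∃ m n, m ≤ n ∧ n ≤ n₀ ∧ π.TwoWay (π.toFun x).1 m n x.1 x'.1) ∧
      ∃ m n, n₁ ≤ m ∧ m ≤ n ∧ π.TwoWay (π.toFun x).1 m n x.1 x'.1 := by
  set l : ℤ := (Fintype.card (Fin d → Fin d) + 1 : ℕ) * N with hl
  have hl0 : 0 < l := by positivity
  -- Both `[a, n₀]` and `[n₁, b]` get the length `l` that `exists_matching` requires.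
  set a : ℤ := n₀ - l + 1 with ha
  set b : ℤ := n₁ + l - 1 with hb
  set y := π.toFun x with hy
  obtain ⟨q, L, t, hL, hqx, hqx'⟩ := exists_periodic_visit hirr hstep x x' (a := a) (b := b)
    (by omega)
  -- With `q` among the representatives, the index `i₀` stands for `x` in the system `v` below and
  -- for `x'` in every system `u h`.
  obtain ⟨p, i₀, hi₀, hp, hpe⟩ := exists_representatives_through hstep hπ q (hd _)
  obtain ⟨R, hR⟩ := exists_threshold hstep hπ hp hpe
  have hyx : ∀ (h : ℕ) k, a ≤ k → k ≤ b → (π.toFun q).1 (k + h * L) = y.1 k := fun h k hk hk' =>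
    hπ.map_eq (hqx k hk hk' h)
  have hyx' : ∀ (h : ℕ) k, a ≤ k → k ≤ b → (π.toFun q).1 (k + (t + h * L)) = y.1 k :=
    fun h k hk hk' => by rw [he]; exact hπ.map_eq (hqx' k hk hk' h)
  have hover : ∀ s, (∀ k, a ≤ k → k ≤ b → (π.toFun q).1 (k + s) = y.1 k) → ∀ i,
      π.IsOver y.1 a b (translate s (p i)) := by
    intro s hs i k hk hk'
    rw [map_translate_apply, hp, add_comm, hs k hk hk']
  have hback : ∀ s, (∀ k, a ≤ k → k ≤ b → (π.toFun q).1 (k + s) = y.1 k) → ∀ i j,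
      π.Conn y.1 a b ((translate s (p i)).1 a) ((translate s (p j)).1 b) →
      π.Conn (π.toFun q).1 (a + s) (b + s) ((p i).1 (a + s)) ((p j).1 (b + s)) := by
    intro s hs i j h
    simpa [add_comm] using h.translate s hs
  have hsep : ∀ s, (∀ k, a ≤ k → k ≤ b → (π.toFun q).1 (k + s) = y.1 k) → R ≤ a + s → ∀ i j,
      π.TwoWay y.1 a b (translate s (p i)).1 (translate s (p j)).1 → i = j := fun s hs hRs i j h =>
    hR (a + s) hRs (b + s) (by omega) i j ⟨hback s hs i j h.1, hback s hs j i h.2⟩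
  have hlarge : ∀ c : ℤ, ∃ h : ℕ, ∀ h' ≥ h, c ≤ h' * L := fun c => ⟨c.toNat, fun h' hh => by
    have : (c.toNat : ℤ) ≤ h' := by exact_mod_cast hh
    nlinarith [Int.self_le_toNat c]⟩
  obtain ⟨h₀, hh₀⟩ := hlarge (R - a)
  obtain ⟨h₁, hh₁⟩ := hlarge (R - a - t)
  set v : Fin d → X.carrier := fun i => translate (h₀ * L) (p i) with hv
  -- One system for each late visit to `x'`: transitions between the `p i` require arbitrarily late
  -- visits.
  set u : ℕ → Fin d → X.carrier := fun h i => translate (t + (h₁ + h : ℕ) * L) (p i) with hu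
  have hvo : ∀ i, π.IsOver y.1 a b (v i) := hover _ (hyx h₀)
  have huo : ∀ h i, π.IsOver y.1 a b (u h i) := fun h => hover _ (hyx' _)
  have hvs : ∀ i j, π.TwoWay y.1 a b (v i).1 (v j).1 → i = j :=
    hsep _ (hyx h₀) (by have := hh₀ h₀ le_rfl; omega)
  have hus : ∀ h i j, π.TwoWay y.1 a b (u h i).1 (u h j).1 → i = j := fun h =>
    hsep _ (hyx' _) (by have := hh₁ (h₁ + h) (by omega); omega)
  have hvx : ∀ k, a ≤ k → k ≤ b → (v i₀).1 k = x.1 k := fun k hk hk' => by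
    rw [hv, translate_apply, hi₀, add_comm, hqx k hk hk']
  have hux : ∀ h k, a ≤ k → k ≤ b → (u h i₀).1 k = x'.1 k := fun h k hk hk' => by
    rw [hu, translate_apply, hi₀, add_comm, hqx' k hk hk']
  have hleft : ∀ h, ∃ φ : Equiv.Perm (Fin d), ∀ i, π.TwoWay y.1 a n₀ (u h i).1 (v (φ i)).1 :=
    fun h => hT.exists_matching hstep hπ hN (by omega)
      (fun i => (hvo i).mono le_rfl (by omega)) (fun i => (huo h i).mono le_rfl (by omega))
      (fun i j hij => hvs i j (hij.extend hstep hπ le_rfl (by omega) (by omega) (hvo i) (hvo j)))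
      (fun i j hij => hus h i j
        (hij.extend hstep hπ le_rfl (by omega) (by omega) (huo h i) (huo h j)))
  have hright : ∀ h, ∃ φ : Equiv.Perm (Fin d), ∀ i, π.TwoWay y.1 n₁ b (u h i).1 (v (φ i)).1 :=
    fun h => hT.exists_matching hstep hπ hN (by omega)
      (fun i => (hvo i).mono (by omega) le_rfl) (fun i => (huo h i).mono (by omega) le_rfl)
      (fun i j hij => hvs i j (hij.extend hstep hπ (by omega) (by omega) le_rfl (hvo i) (hvo j)))
      (fun i j hij => hus h i j
        (hij.extend hstep hπ (by omega) (by omega) le_rfl (huo h i) (huo h j)))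
  choose φ hφ using hleft
  choose ψ hψ using hright
  -- There are finitely many pairs of permutations, so one pair occurs at infinitely many visits.
  obtain ⟨⟨φ', ψ'⟩, hinf⟩ := Finite.exists_infinite_fiber fun h => (φ h, ψ h)
  rw [Set.infinite_coe_iff] at hinf
  have hφψ : φ' = ψ' := by
    have hτ : ψ'⁻¹ * φ' = 1 := by
      refine perm_eq_one_of_rightTransition hstep hπ hpe fun i => ?_
      rw [rightTransition_iff hstep hπ]
      refine ⟨by rw [hp, hp], fun m => ?_⟩
      obtain ⟨g, hg⟩ := hlarge (m - a - t + 1)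
      obtain ⟨h, hh, hgh⟩ := hinf.exists_gt g
      obtain ⟨rfl, rfl⟩ : φ h = φ' ∧ ψ h = ψ' := by simpa using hh
      -- `u h i` crosses to `v (φ i)` on the left and from there to `u h (ψ⁻¹ (φ i))` on the right;
      -- translated back, this is a path from `p i` to `p (ψ⁻¹ (φ i))` beyond `m`.
      have h1 := (hφ h i).1
      have h2 := (hψ h (((ψ h)⁻¹ * φ h) i)).2
      rw [Equiv.Perm.mul_apply, Equiv.Perm.inv_def, Equiv.apply_symm_apply] at h2
      have h3 := (h1.trans hstep hπ (by omega) hn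
        ((hvo (φ h i)).mono (by omega) (by omega)).conn).trans hstep hπ (by omega) (by omega) h2
      have h4 := hback _ (hyx' _) _ _ h3
      have h5 := hg (h₁ + h) (by omega)
      rw [hp]
      refine ⟨b + (t + (h₁ + h : ℕ) * L), by omega, ?_⟩
      exact h4.extend hstep hπ (by omega) (by omega) le_rfl (isOver_of_eq (hp _) _ _)
        (isOver_of_eq (hp _) _ _)
    exact (inv_mul_eq_one.1 hτ).symm
  subst hφψ
  obtain ⟨h, hh⟩ := hinf.nonempty
  obtain ⟨h1, h2⟩ : φ h = φ' ∧ ψ h = φ' := by simpa using hh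
  have hl1 := hφ h i₀
  have hr1 := hψ h i₀
  rw [h1] at hl1
  rw [h2] at hr1
  -- Where `x` and `x'` agree, `u h i₀` and `v i₀` have the same end symbols, so `v i₀` is two-way
  -- connected to `v (φ' i₀)`.
  have hfix : φ' i₀ = i₀ := by
    rcases hx with hx | hx
    · refine (hvs i₀ _ (TwoWay.extend hstep hπ le_rfl (m := a) (n := n₀) (by omega) (by omega) ?_
        (hvo _) (hvo _))).symm
      rw [TwoWay, hux h a le_rfl (by omega), hux h n₀ (by omega) (by omega), ← hx a (by omega),
        ← hx n₀ le_rfl, ← hvx a le_rfl (by omega), ← hvx n₀ (by omega) (by omega)] at hl1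
      exact hl1
    · refine (hvs i₀ _ (TwoWay.extend hstep hπ (m := n₁) (n := b) (by omega) (by omega) le_rfl ?_
        (hvo _) (hvo _))).symm
      rw [TwoWay, hux h b (by omega) le_rfl, hux h n₁ (by omega) (by omega), ← hx b (by omega),
        ← hx n₁ le_rfl, ← hvx b (by omega) le_rfl, ← hvx n₁ (by omega) (by omega)] at hr1
      exact hr1
  rw [hfix, TwoWay, hux h a le_rfl (by omega), hux h n₀ (by omega) (by omega),
    hvx a le_rfl (by omega), hvx n₀ (by omega) (by omega)] at hl1
  rw [hfix, TwoWay, hux h b (by omega) le_rfl, hux h n₁ (by omega) (by omega),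
    hvx b (by omega) le_rfl, hvx n₁ (by omega) (by omega)] at hr1
  exact ⟨⟨a, n₀, by omega, le_rfl, hl1.2, hl1.1⟩, n₁, b, le_rfl, by omega, hr1.2, hr1.1⟩

lemma isRightClassClosing_of_isTangledAt (hirr : IsIrreducible X) (hstep : IsStepSFT 1 X)
    (hπ : π.IsOneBlock) {d N : ℕ} (hN : 0 < N) (hd : ∀ y, π.rightClassCount y = d)
    (hT : π.IsTangledAt d N) : π.IsRightClassClosing := by
  have key : ∀ x x' : X.carrier, LeftAsymptotic x.1 x'.1 → π.toFun x = π.toFun x' →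
      π.RightTransition x x' := by
    rintro x x' ⟨n₀, hn₀⟩ he
    rw [rightTransition_iff hstep hπ]
    refine ⟨he, fun c => ?_⟩
    -- Taking `max n₀ c` as the right bound pushes the connection past `c`; the end `n + 1` below
    -- makes the inequality strict.
    obtain ⟨-, m, n, hm, hmn, h, -⟩ := exists_twoWay_of_asymptotic hirr hstep hπ hN hd hT he
      (le_max_left n₀ c) (.inl hn₀)
    have hc := le_max_right n₀ c
    exact ⟨n + 1, by omega, h.extend hstep hπ (by omega) hmn (by omega) (isOver_of_eq rfl _ _)
      (isOver_of_eq he.symm _ _)⟩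
  exact fun x x' h he => ⟨key x x' h he, key x' x (h.imp fun n hn i hi => (hn i hi).symm) he.symm⟩

lemma isLeftClassClosing_of_isTangledAt (hirr : IsIrreducible X) (hstep : IsStepSFT 1 X)
    (hπ : π.IsOneBlock) {d N : ℕ} (hN : 0 < N) (hd : ∀ y, π.rightClassCount y = d)
    (hT : π.IsTangledAt d N) : π.IsLeftClassClosing := by
  have key : ∀ x x' : X.carrier, RightAsymptotic x.1 x'.1 → π.toFun x = π.toFun x' →
      π.LeftTransition x x' := by
    rintro x x' ⟨n₁, hn₁⟩ he
    refine leftTransition_of_conn hstep hπ he fun c => ?_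
    obtain ⟨⟨m, n, hmn, hn, -, h⟩, -⟩ := exists_twoWay_of_asymptotic hirr hstep hπ hN hd hT he
      (min_le_left n₁ c) (.inr hn₁)
    have hc := min_le_right n₁ c
    exact ⟨m - 1, by omega, h.extend hstep hπ (by omega) hmn (by omega) (isOver_of_eq he.symm _ _)
      (isOver_of_eq rfl _ _)⟩
  exact fun x x' h he => ⟨key x x' h he, key x' x (h.imp fun n hn i hi => (hn i hi).symm) he.symm⟩

end FactorCode

end ClassDegree

theorem mainTheorem5 {A B : Type*} [Finite A] [TopologicalSpace A] [DiscreteTopology A]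
    [Finite B] [TopologicalSpace B] [DiscreteTopology B]
    (X : SymbolicDynamics.FullShift.Subshift A ℤ) (Y : SymbolicDynamics.FullShift.Subshift B ℤ)
    (hirr : ClassDegree.IsIrreducible X) (hstep : ClassDegree.IsStepSFT 1 X)
    (π : ClassDegree.FactorCode X Y) (hπ : π.IsOneBlock) (d : ℕ) :
    List.TFAE
      [π.IsConstantClassToOne ∧ π.classDegree = d,
       π.IsMinimalDepth d ∧
         ∃ N > 0, ∀ w ∈ ClassDegree.language Y, w.length = N → π.depth w = d,
       π.IsMinimalTDepth d ∧
         ∃ N > 0, ∀ w ∈ ClassDegree.language Y, w.length = N → π.tDepth w = d] ∧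
    ((π.IsConstantClassToOne ∧ π.classDegree = d) ∨
       (π.IsMinimalDepth d ∧
         ∃ N > 0, ∀ w ∈ ClassDegree.language Y, w.length = N → π.depth w = d) ∨
       (π.IsMinimalTDepth d ∧
         ∃ N > 0, ∀ w ∈ ClassDegree.language Y, w.length = N → π.tDepth w = d) →
      π.IsBiClassClosing ∧ π.IsBiContinuing) := by
  have htfae := ClassDegree.FactorCode.tfae_constant hirr hstep hπ d
  refine ⟨htfae, fun hany => ?_⟩
  have h1 : π.IsConstantClassToOne ∧ π.classDegree = d := by
    rcases hany with h | h | h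
    · exact h
    · exact (htfae.out 1 0).1 h
    · exact (htfae.out 2 0).1 h
  -- The uniform t-depth `d` at length `N` is exactly what yields `IsTangledAt`.
  obtain ⟨-, N, hN, hw⟩ := (htfae.out 0 2).1 h1
  have hd : ∀ y, π.rightClassCount y = d := fun y => (h1.1 y).trans h1.2
  have hT : π.IsTangledAt d N := fun y m p hp =>
    ClassDegree.FactorCode.exists_twoWay_of_tDepth_le hN
      (hw _ (ClassDegree.block_mem_language y m N) (by simp)).le hp
  exact ⟨⟨π.isRightClassClosing_of_isTangledAt hirr hstep hπ hN hd hT,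
    π.isLeftClassClosing_of_isTangledAt hirr hstep hπ hN hd hT⟩,
    π.isRightContinuing_of_isTangledAt hirr hstep hπ hN hd hT,
    π.isLeftContinuing_of_isTangledAt hirr hstep hπ hN hd hT⟩
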